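/- Let $q$ be a prime power and $\mathbb{F}_q$ the finite field with $q$ elements. For a tuple $\mathbf l=(l_1,\dots,l_s)$ of nonnegative integers let $M^{\mathbf l}(q)$ be the set of block upper triangular matrices over $\mathbb{F}_q$ with diagonal blocks of sizes $l_1,\dots,l_s$, let $P^{\mathbf l}(q)$ be the group of invertible elements of $M^{\mathbf l}(q)$, acting on $M^{\mathbf l}(q)$ by conjugation, and let $\rho_{\mathbf l}(q)$ be the number of $P^{\mathbf l}(q)$-orbits on the set of nilpotent matrices in $M^{\mathbf l}(q)$. For a subset $F$ of the algebraic closure $\overline{\mathbb{F}}_q$, the class $\mathcal Y=\mathcal Y_F$ consists of all endomorphisms $T$ of finite-dimensional $\mathbb{F}_q$-vector spaces such that all eigenvalues of $T$ over $\overline{\mathbb{F}}_q$ lie in $F$. Let $c(n,\mathcal Y)$ be the number of $\mathrm{GL}_n(\mathbb{F}_q)$-conjugacy orbits on the set of $n\times n$ matrices over $\mathbb{F}_q$ that belong to $\mathcal Y$ (so $c(0,\mathcal Y)=1$). Let $p(n)$ be the number of partitions of $n$, and let $\mathcal P_j^m$ be the set of partitions of $j$ all of whose parts are at most $m$. For a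 partition $\lambda=(\lambda_1\ge\dots\ge\lambda_r)$ with all parts at most $m$ put $$\delta(m,\lambda)=(\lambda_r,\ \lambda_{r-1}-\lambda_r,\ \dots,\ \lambda_1-\lambda_2,\ m-\lambda_1),\qquad \delta(m,\varnothing)=(m),$$ let $\kappa_\lambda^m(\mathcal Y)$ be the number of $P^{\delta(m,\lambda)}(q)$-orbits on $M^{\delta(m,\lambda)}(q)\cap\mathcal Y$, and let $\nu_\lambda^m(q)=\rho_{\delta(m,\lambda)}(q)$. **Theorem.** Let $k$ and $m$ be positive integers, let $q$ be a prime power, and let $\mathcal Y=\mathcal Y_F$ be the class of endomorphisms over $\mathbb{F}_q$ associated with a subset $F\subseteq\overline{\mathbb{F}}_q$. Then $$\kappa_{(k)}^{k+m}(\mathcal Y)=\sum_{j=0}^{k} c(k-j,\mathcal Y)\sum_{\lambda\in\mathcal P_j^m}\kappa_\lambda^m(\mathcal Y).$$ In particular, $$\rho_{(k,m)}(q)=\sum_{j=0}^{k} p(k-j)\sum_{\lambda\in\mathcal P_j^m}\nu_\lambda^m(q).$$ -/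

import Mathlib

open Matrix
open scoped TensorProduct

/-- The number `γ(G, X)` of orbits of a group `G` acting on `X`. -/
noncomputable def orbitCount (G X : Type*) [Group G] [MulAction G X] : ℕ :=
  Nat.card (MulAction.orbitRel.Quotient G X)

/-- The class `𝒴_F` of endomorphisms attached to a set `F` of elements of the algebraic closure:
`T` is in the class iff every eigenvalue of `T` over the algebraic closure lies in `F`. -/
def IsClassEnd {K : Type*} [Field K] (F : Set (AlgebraicClosure K))
    {U : Type*} [AddCommGroup U] [Module K U] (T : Module.End K U) : Prop :=
  ∀ μ : AlgebraicClosure K,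
    Module.End.HasEigenvalue (LinearMap.baseChange (AlgebraicClosure K) T) μ → μ ∈ F

/-- Membership in a class is preserved by conjugation. -/
theorem IsClassEnd.conj {K : Type*} [Field K] {F : Set (AlgebraicClosure K)}
    {U : Type*} [AddCommGroup U] [Module K U] {T g h : Module.End K U}
    (hT : IsClassEnd F T) (hgh : h * g = 1) (hhg : g * h = 1) :
    IsClassEnd F (g * T * h) := by
  intro μ hμ
  apply hT μ
  obtain ⟨v, hv⟩ := hμ.exists_hasEigenvector
  have h1 : LinearMap.baseChange (AlgebraicClosure K) g
      (LinearMap.baseChange (AlgebraicClosure K) h v) = v := by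
    have := congrArg (fun f : Module.End K U => LinearMap.baseChange (AlgebraicClosure K) f v) hhg
    simpa [Module.End.mul_eq_comp, Module.End.one_eq_id, LinearMap.baseChange_comp] using this
  have h2 : ∀ w, LinearMap.baseChange (AlgebraicClosure K) h
      (LinearMap.baseChange (AlgebraicClosure K) g w) = w := fun w => by
    have := congrArg (fun f : Module.End K U => LinearMap.baseChange (AlgebraicClosure K) f w) hgh
    simpa [Module.End.mul_eq_comp, Module.End.one_eq_id, LinearMap.baseChange_comp] using this
  have h3 := hv.apply_eq_smul
  simp only [Module.End.mul_eq_comp, LinearMap.baseChange_comp, LinearMap.comp_apply] at h3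
  refine Module.End.hasEigenvalue_of_hasEigenvector
    (x := LinearMap.baseChange (AlgebraicClosure K) h v) ⟨?_, ?_⟩
  · rw [Module.End.mem_eigenspace_iff, ← map_smul, ← h3, h2]
  · intro h0
    apply hv.2
    rw [← h1, h0, map_zero]

/-- The set `𝒴_F ∩ M_ι(K)` of the matrices whose endomorphism is in the class `𝒴_F`, with the
conjugation action of `GL_ι(K)` (`ConjAct` is Mathlib's conjugation action `g • A = g * A * g⁻¹`).
-/
def classMatrices {K : Type*} [Field K] (F : Set (AlgebraicClosure K))
    (ι : Type*) [Fintype ι] [DecidableEq ι] :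
    SubMulAction (ConjAct (GL ι K)) (Matrix ι ι K) where
  carrier := {A | IsClassEnd F (Matrix.toLin' A)}
  smul_mem' g A hA := by
    have h : Matrix.toLin' (g • A) =
        Matrix.toLin' (ConjAct.ofConjAct g : GL ι K).val * Matrix.toLin' A *
          Matrix.toLin' ((ConjAct.ofConjAct g)⁻¹ : GL ι K).val := by
      rw [ConjAct.units_smul_def, Matrix.toLin'_mul, Matrix.toLin'_mul]
      rfl
    change IsClassEnd F _
    rw [h]
    refine IsClassEnd.conj hA ?_ ?_
    · rw [Module.End.mul_eq_comp, ← Matrix.toLin'_mul, ← Units.val_mul, inv_mul_cancel,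
        Units.val_one, Matrix.toLin'_one]
      rfl
    · rw [Module.End.mul_eq_comp, ← Matrix.toLin'_mul, ← Units.val_mul, mul_inv_cancel,
        Units.val_one, Matrix.toLin'_one]
      rfl

/-- The set of nilpotent matrices, with the conjugation action of `GL_ι(K)`. -/
def nilpotentMatrices (K : Type*) [Field K] (ι : Type*) [Fintype ι] [DecidableEq ι] :
    SubMulAction (ConjAct (GL ι K)) (Matrix ι ι K) where
  carrier := {A | IsNilpotent A}
  smul_mem' g A hA := by
    obtain ⟨n, hn⟩ := hA
    refine ⟨n, ?_⟩
    rw [← smul_pow', hn, smul_zero]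

/-- Row and column indices of block matrices with block sizes `l = (l₁, …, l_s)`: the pairs
`(a, i)` with `a` the number of the block and `i` the position inside it. -/
abbrev BlockIndex (l : List ℕ) : Type := (a : Fin l.length) × Fin (l.get a)

/-- The parabolic subgroup `P^l(K)`: all invertible block upper triangular matrices with block
sizes `l` (the entries in position `((a, i), (b, j))` with `b < a` vanish). -/
def parabolic (K : Type*) [Field K] (l : List ℕ) : Subgroup (GL (BlockIndex l) K) where
  carrier := {g | g.val.BlockTriangular Sigma.fst}
  mul_mem' ha hb := by
    simpa using Matrix.BlockTriangular.mul ha hb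
  one_mem' := by
    simpa using Matrix.blockTriangular_one
  inv_mem' {g} hg := by
    have : Invertible g.val := g.invertible
    simpa [Matrix.coe_units_inv] using Matrix.blockTriangular_inv_of_blockTriangular hg

/-- `P^l(K)`, viewed as a group acting on matrices by conjugation. -/
def parabolicConj (K : Type*) [Field K] (l : List ℕ) : Subgroup (ConjAct (GL (BlockIndex l) K)) :=
  (parabolic K l).comap ConjAct.ofConjAct.toMonoidHom

/-- The set `M^l(K) ∩ S` of the block upper triangular matrices that lie in a conjugation
invariant set `S`, with the conjugation action of `P^l(K)`. -/
def blockPart {K : Type*} [Field K] (l : List ℕ)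
    (S : SubMulAction (ConjAct (GL (BlockIndex l) K))
      (Matrix (BlockIndex l) (BlockIndex l) K)) :
    SubMulAction (parabolicConj K l) (Matrix (BlockIndex l) (BlockIndex l) K) where
  carrier := {A | A.BlockTriangular Sigma.fst ∧ A ∈ S}
  smul_mem' g A hA := by
    refine ⟨?_, S.smul_mem g.val hA.2⟩
    have hg : ConjAct.ofConjAct g.val ∈ parabolic K l := g.2
    have hg' := (parabolic K l).inv_mem hg
    change ((g : ConjAct (GL (BlockIndex l) K)) • A).BlockTriangular Sigma.fst
    rw [ConjAct.units_smul_def]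
    exact (Matrix.BlockTriangular.mul hg hA.1).mul hg'

/-- `c(n, 𝒴_F)`, the number of `GL_n(K)`-orbits on `𝒴_F ∩ M_n(K)`. -/
noncomputable def classCount {K : Type*} [Field K] (F : Set (AlgebraicClosure K)) (n : ℕ) : ℕ :=
  orbitCount (ConjAct (GL (Fin n) K)) (classMatrices F (Fin n))

/-- `ρ_l`, the number of `P^l(K)`-orbits on the nilpotent matrices in `M^l(K)`. -/
noncomputable def rho (K : Type*) [Field K] (l : List ℕ) : ℕ :=
  orbitCount (parabolicConj K l) (blockPart l (nilpotentMatrices K (BlockIndex l)))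

/-- `δ(m, λ) = (λ_r, λ_{r-1} - λ_r, …, λ₁ - λ₂, m - λ₁)` for a partition `λ₁ ≥ … ≥ λ_r` with
`λ₁ ≤ m`; for the empty partition this is `(m)`. -/
def delta (m : ℕ) {j : ℕ} (lam : Nat.Partition j) : List ℕ :=
  List.zipWith (fun a b => a - b) (lam.parts.sort (· ≤ ·) ++ [m]) (0 :: lam.parts.sort (· ≤ ·))

/-- `κ_λ^m(𝒴_F)`, the number of `P^{δ(m,λ)}(K)`-orbits on `M^{δ(m,λ)}(K) ∩ 𝒴_F`. -/
noncomputable def kappa {K : Type*} [Field K] (F : Set (AlgebraicClosure K)) (m : ℕ) {j : ℕ}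
    (lam : Nat.Partition j) : ℕ :=
  orbitCount (parabolicConj K (delta m lam))
    (blockPart (delta m lam) (classMatrices F (BlockIndex (delta m lam))))

/-- `ν_λ^m = ρ_{δ(m,λ)}`. -/
noncomputable def nu (K : Type*) [Field K] (m : ℕ) {j : ℕ} (lam : Nat.Partition j) : ℕ :=
  rho K (delta m lam)

/-- `𝒫_j^m`, the set of partitions of `j` all of whose parts are at most `m`. -/
def boundedPartitions (j m : ℕ) : Finset (Nat.Partition j) :=
  Finset.univ.filter fun lam => ∀ i ∈ lam.parts, i ≤ m

/-! Burnside's lemma turns orbit numbers into numbers of commuting pairs `(g, A)`, with `g`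
invertible and `A` in the class. Since automorphisms act transitively on flags of given dimensions,
the orbit number for block sizes `l` is `1 / |GL(V)|` times the number of commuting pairs on `V`
together with an invariant flag of the corresponding type (`blockClassCount_mul_glCard`).

The engine is a duality. For diagonal pairs `(g, A)` on `L` and `(h, B)` on `U`, the off-diagonal
blocks that make the triangular endomorphisms commute solve a linear system. The trace pairing shows
that it has `|Hom(U, L)|` times as many solutions as there are intertwining maps `L → U`
(`card_commutingBlocks`). So for blocks `(k, m)` the orbit number becomes a count of pairs on `K ^
k` with an intertwining map to a pair on `K ^ m`, weighted by `1 / (|GL_k| |GL_m|)`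
(`blockClassCount_pair_mul`).

Sort these maps by their image `W`, an invariant subspace. Applied to the kernel and the image, the
same duality shows that maps from `K ^ k` onto `W`, divided by `|GL_k|`, are as many as maps from `K
^ (k - dim W)` into `W`, divided by `|GL_(k - dim W)|` (`homOnto_mul`). Iterating produces
descending chains of nonzero invariant subspaces of `K ^ m` with dimensions `λ₁ ≥ λ₂ ≥ …` of sum
`j`, and a remaining factor `c(k - j)` (`homInto_div_eq_sum`). The partial sums of `δ(m, λ)` are the
parts of `λ` followed by `m`, so summing over all pairs on `K ^ m` gives `κ_λ^m`.

The nilpotent statement is the case `F = {0}`, where Jordan normal form gives `c(n) = p(n)`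
(`classCount_singleton_zero`). -/

/-! ### Classes of endomorphisms through characteristic polynomials -/

section ClassEnd
variable {K : Type*} [Field K] {F : Set (AlgebraicClosure K)}
  {V V' L U : Type*} [AddCommGroup V] [Module K V] [AddCommGroup V'] [Module K V']
  [AddCommGroup L] [Module K L] [AddCommGroup U] [Module K U]

theorem isClassEnd_iff_charpoly [Module.Finite K V] {T : Module.End K V} :
    IsClassEnd F T ↔ ∀ μ : AlgebraicClosure K, Polynomial.aeval μ T.charpoly = 0 → μ ∈ F := by
  unfold IsClassEnd
  refine forall_congr' fun μ => ?_
  rw [Module.End.hasEigenvalue_iff_isRoot_charpoly, LinearMap.charpoly_baseChange,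
    Polynomial.IsRoot.def, Polynomial.eval_map_algebraMap]

theorem isClassEnd_conj_iff [Module.Finite K V] [Module.Finite K V'] (e : V ≃ₗ[K] V')
    {T : Module.End K V} : IsClassEnd F (e.conj T) ↔ IsClassEnd F T := by
  rw [isClassEnd_iff_charpoly, isClassEnd_iff_charpoly, LinearEquiv.charpoly_conj]

/-- Invertibility is itself a class condition, so both members of a commuting pair are governed by
the same lemmas on blocks and restrictions. -/
theorem isUnit_iff_isClassEnd [Module.Finite K V] {T : Module.End K V} :
    IsUnit T ↔ IsClassEnd ({0}ᶜ : Set (AlgebraicClosure K)) T := by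
  rw [isClassEnd_iff_charpoly, LinearMap.isUnit_iff_isUnit_det, isUnit_iff_ne_zero,
    LinearMap.det_eq_sign_charpoly_coeff]
  have h : Polynomial.aeval (0 : AlgebraicClosure K) T.charpoly = 0 ↔ T.charpoly.coeff 0 = 0 := by
    rw [← Polynomial.coeff_zero_eq_aeval_zero', map_eq_zero]
  constructor
  · intro hT μ hμ h0
    rw [Set.mem_singleton_iff] at h0
    subst h0
    exact hT (by rw [h.1 hμ, mul_zero])
  · intro hT h0
    exact hT 0 (h.2 (by simpa using h0)) rfl

theorem isNilpotent_iff_isClassEnd [Module.Finite K V] {T : Module.End K V} :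
    IsNilpotent T ↔ IsClassEnd ({0} : Set (AlgebraicClosure K)) T := by
  rw [isClassEnd_iff_charpoly, LinearMap.isNilpotent_iff_charpoly]
  constructor
  · intro hT μ hμ
    rw [hT] at hμ
    rw [map_pow, Polynomial.aeval_X] at hμ
    exact eq_zero_of_pow_eq_zero hμ
  · intro hT
    -- Over the algebraic closure the polynomial splits with all roots zero, hence is a power of
    -- `X`.
    apply Polynomial.map_injective _ (algebraMap K (AlgebraicClosure K)).injective
    have hm := (LinearMap.charpoly_monic T).map (algebraMap K (AlgebraicClosure K))
    have hs := IsAlgClosed.splits (T.charpoly.map (algebraMap K (AlgebraicClosure K)))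
    have hr : (T.charpoly.map (algebraMap K (AlgebraicClosure K))).roots =
        Multiset.replicate (Module.finrank K V) 0 := by
      rw [Multiset.eq_replicate, ← hs.natDegree_eq_card_roots, Polynomial.natDegree_map,
        LinearMap.charpoly_natDegree]
      refine ⟨rfl, fun μ hμ => hT μ ?_⟩
      rw [Polynomial.mem_roots hm.ne_zero, Polynomial.IsRoot.def,
        Polynomial.eval_map_algebraMap] at hμ
      exact hμ
    rw [hs.eq_prod_roots_of_monic hm, hr]
    simp

/-- The endomorphism of `L × U` that is block upper triangular with blocks `a`, `x`, `h`. -/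
def blockEnd (a : Module.End K L) (x : U →ₗ[K] L) (h : Module.End K U) : Module.End K (L × U) :=
  (a.coprod x).prod (h.comp (LinearMap.snd K L U))

theorem charpoly_blockEnd [Module.Finite K L] [Module.Finite K U]
    (a : Module.End K L) (x : U →ₗ[K] L) (h : Module.End K U) :
    (blockEnd a x h).charpoly = a.charpoly * h.charpoly := by
  let b₁ := Module.Free.chooseBasis K L
  let b₂ := Module.Free.chooseBasis K U
  rw [← LinearMap.charpoly_toMatrix a b₁, ← LinearMap.charpoly_toMatrix h b₂,
    ← LinearMap.charpoly_toMatrix _ (b₁.prod b₂),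
    ← Matrix.charpoly_fromBlocks_zero₂₁ (M₁₂ := LinearMap.toMatrix b₂ b₁ x)]
  congr 1
  ext i j
  rcases i with i | i <;> rcases j with j | j <;>
    simp [blockEnd, LinearMap.toMatrix_apply]

theorem isClassEnd_blockEnd_iff [Module.Finite K L] [Module.Finite K U]
    {a : Module.End K L} {x : U →ₗ[K] L} {h : Module.End K U} :
    IsClassEnd F (blockEnd a x h) ↔ IsClassEnd F a ∧ IsClassEnd F h := by
  simp only [isClassEnd_iff_charpoly, charpoly_blockEnd, map_mul, mul_eq_zero]
  exact ⟨fun H => ⟨fun μ hμ => H μ (Or.inl hμ), fun μ hμ => H μ (Or.inr hμ)⟩,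
    fun H μ hμ => hμ.elim (H.1 μ) (H.2 μ)⟩

/-- By flatness the base change of `i` stays injective, so it carries eigenvectors of `S` to
eigenvectors of `T`. -/
theorem IsClassEnd.of_injective {T : Module.End K V} {S : Module.End K V'} {i : V' →ₗ[K] V}
    (hi : Function.Injective i) (h : T ∘ₗ i = i ∘ₗ S) (hT : IsClassEnd F T) : IsClassEnd F S := by
  intro μ hμ
  obtain ⟨v, hv⟩ := hμ.exists_hasEigenvector
  have hinj : Function.Injective (i.baseChange (AlgebraicClosure K)) :=
    Module.Flat.lTensor_preserves_injective_linearMap i hi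
  refine hT μ (Module.End.hasEigenvalue_of_hasEigenvector
    (x := i.baseChange (AlgebraicClosure K) v) ⟨?_, ?_⟩)
  · rw [Module.End.mem_eigenspace_iff, ← LinearMap.comp_apply, ← LinearMap.baseChange_comp, h,
      LinearMap.baseChange_comp, LinearMap.comp_apply, hv.apply_eq_smul, map_smul]
  · intro h0
    exact hv.2 (hinj (h0.trans (map_zero _).symm))

theorem isUnit_blockEnd_iff [Module.Finite K L] [Module.Finite K U]
    {a : Module.End K L} {x : U →ₗ[K] L} {h : Module.End K U} :
    IsUnit (blockEnd a x h) ↔ IsUnit a ∧ IsUnit h := by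
  simp only [isUnit_iff_isClassEnd, isClassEnd_blockEnd_iff]

end ClassEnd

/-! ### Trace duality between commuting blocks and intertwining maps -/

section Duality
variable {K : Type*} [Field K] {L U : Type*} [AddCommGroup L] [Module K L] [AddCommGroup U]
  [Module K U]

/-- The trace pairing between `Hom(L, U)` and `Hom(U, L)`. -/
noncomputable def tracePairing (K L U : Type*) [Field K] [AddCommGroup L] [Module K L]
    [AddCommGroup U] [Module K U] :
    (L →ₗ[K] U) →ₗ[K] Module.Dual K (U →ₗ[K] L) :=
  LinearMap.mk₂ K (fun Y X => LinearMap.trace K L (X ∘ₗ Y))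
    (fun _ _ _ => by simp [LinearMap.comp_add]) (fun _ _ _ => by simp [LinearMap.comp_smul])
    (fun _ _ _ => by simp [LinearMap.add_comp]) (fun _ _ _ => by simp [LinearMap.smul_comp])

theorem tracePairing_apply (Y : L →ₗ[K] U) (X : U →ₗ[K] L) :
    tracePairing K L U Y X = LinearMap.trace K L (X ∘ₗ Y) := rfl

variable [Module.Finite K L] [Module.Finite K U]

/-- Pairing `Y` with the rank-one map `u ↦ f u • l` gives `f (Y l)`, so the pairing is
nondegenerate; the dimensions agree. -/
theorem tracePairing_bijective : Function.Bijective (tracePairing K L U) := by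
  have hinj : Function.Injective (tracePairing K L U) := by
    rw [injective_iff_map_eq_zero]
    intro Y hY
    ext l
    by_contra hl
    obtain ⟨f, hf⟩ : ∃ f : Module.Dual K U, f (Y l) ≠ 0 := by
      by_contra! H
      exact hl ((Module.forall_dual_apply_eq_zero_iff K _).1 H)
    have h := LinearMap.congr_fun hY (f.smulRight l)
    rw [tracePairing_apply] at h
    have h2 : (f.smulRight l) ∘ₗ Y = (f ∘ₗ Y).smulRight l := by ext; simp
    rw [h2, LinearMap.trace_smulRight] at h
    exact hf h
  refine ⟨hinj, ?_⟩
  have : Module.finrank K (L →ₗ[K] U) = Module.finrank K (Module.Dual K (U →ₗ[K] L)) := by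
    rw [Subspace.dual_finrank_eq, Module.finrank_linearMap, Module.finrank_linearMap, mul_comm]
  exact (LinearMap.injective_iff_surjective_of_finrank_eq_finrank this).1 hinj

/-- The pairs of off-diagonal blocks for which two block triangular endomorphisms commute. -/
def commutingBlocks (g A : Module.End K L) (h B : Module.End K U) :
    Submodule K ((U →ₗ[K] L) × (U →ₗ[K] L)) where
  carrier := {p | g ∘ₗ p.2 + p.1 ∘ₗ B = A ∘ₗ p.1 + p.2 ∘ₗ h}
  add_mem' {p q} hp hq := by
    simp only [Set.mem_ofPred_eq, Prod.fst_add, Prod.snd_add, LinearMap.comp_add,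
      LinearMap.add_comp] at *
    rw [add_add_add_comm, hp, hq, add_add_add_comm]
  zero_mem' := by simp
  smul_mem' c p hp := by
    simp only [Set.mem_ofPred_eq, Prod.smul_fst, Prod.smul_snd, LinearMap.comp_smul,
      LinearMap.smul_comp] at *
    rw [← smul_add, hp, smul_add]

/-- The homomorphisms that intertwine `g` with `h` and `A` with `B`. -/
def intertwiners (g A : Module.End K L) (h B : Module.End K U) : Submodule K (L →ₗ[K] U) where
  carrier := {Y | Y ∘ₗ g = h ∘ₗ Y ∧ Y ∘ₗ A = B ∘ₗ Y}
  add_mem' {p q} hp hq := by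
    simp only [Set.mem_ofPred_eq, LinearMap.comp_add, LinearMap.add_comp] at *
    rw [hp.1, hq.1, hp.2, hq.2]
    exact ⟨rfl, rfl⟩
  zero_mem' := by simp
  smul_mem' c p hp := by
    simp only [Set.mem_ofPred_eq, LinearMap.comp_smul, LinearMap.smul_comp] at *
    rw [hp.1, hp.2]
    exact ⟨rfl, rfl⟩

/-- The commuting blocks are the kernel of a linear map `Φ` from two copies of `Hom(U, L)` to one.
Under the trace pairing the annihilator of the range of `Φ` is the space of intertwiners, so
rank-nullity gives the formula. -/
theorem finrank_commutingBlocks (g A : Module.End K L) (h B : Module.End K U) :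
    Module.finrank K (commutingBlocks g A h B) =
      Module.finrank K (U →ₗ[K] L) + Module.finrank K (intertwiners g A h B) := by
  let Φ : ((U →ₗ[K] L) × (U →ₗ[K] L)) →ₗ[K] (U →ₗ[K] L) :=
    LinearMap.coprod (LinearMap.lcomp K L B - LinearMap.llcomp K U L L A)
      (LinearMap.llcomp K U L L g - LinearMap.lcomp K L h)
  have hΦ : ∀ X Z, Φ (X, Z) = (X ∘ₗ B - A ∘ₗ X) + (g ∘ₗ Z - Z ∘ₗ h) := fun X Z => rfl
  have hker : LinearMap.ker Φ = commutingBlocks g A h B := by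
    ext ⟨X, Z⟩
    rw [LinearMap.mem_ker, hΦ]
    change _ ↔ g ∘ₗ Z + X ∘ₗ B = A ∘ₗ X + Z ∘ₗ h
    rw [← sub_eq_zero (a := g ∘ₗ Z + X ∘ₗ B)]
    refine Eq.congr ?_ rfl
    abel
  have hint : intertwiners g A h B =
      (LinearMap.range Φ).dualAnnihilator.comap (tracePairing K L U) := by
    ext Y
    rw [Submodule.mem_comap, Submodule.mem_dualAnnihilator]
    -- Cyclicity of the trace moves `A` and `g` to the other side of `Y`; the adjoint of `Φ`
    -- measures the failure of `Y` to intertwine.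
    have key : ∀ X Z, tracePairing K L U Y (Φ (X, Z)) =
        tracePairing K L U (B ∘ₗ Y - Y ∘ₗ A) X + tracePairing K L U (Y ∘ₗ g - h ∘ₗ Y) Z := by
      intro X Z
      have h1 := LinearMap.trace_comp_comm' A (X ∘ₗ Y)
      have h2 := LinearMap.trace_comp_comm' g (Z ∘ₗ Y)
      simp only [LinearMap.comp_assoc] at h1 h2
      rw [map_sub (tracePairing K L U), map_sub (tracePairing K L U), LinearMap.sub_apply,
        LinearMap.sub_apply]
      simp only [tracePairing_apply, hΦ, map_add, map_sub, LinearMap.comp_assoc, h1, h2]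
    constructor
    · rintro ⟨h1, h2⟩ _ ⟨⟨X, Z⟩, rfl⟩
      rw [key, h1, h2, sub_self, sub_self, map_zero]
      simp
    · intro H
      have h1 : tracePairing K L U (B ∘ₗ Y - Y ∘ₗ A) = 0 := by
        ext X
        have := H _ ⟨(X, 0), rfl⟩
        rw [key] at this
        simpa using this
      have h2 : tracePairing K L U (Y ∘ₗ g - h ∘ₗ Y) = 0 := by
        ext X
        have := H _ ⟨(0, X), rfl⟩
        rw [key] at this
        simpa using this
      have inj := (injective_iff_map_eq_zero _).1 (tracePairing_bijective (K := K) (L := L) (U := U)).1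
      exact ⟨sub_eq_zero.1 (inj _ h2), (sub_eq_zero.1 (inj _ h1)).symm⟩
  have h1 : Module.finrank K (intertwiners g A h B) =
      Module.finrank K (LinearMap.range Φ).dualAnnihilator := by
    rw [hint]
    let e := LinearEquiv.ofBijective (tracePairing K L U) tracePairing_bijective
    exact LinearEquiv.finrank_eq (e.ofSubmodule' _)
  have h2 := LinearMap.finrank_range_add_finrank_ker Φ
  have h3 := Subspace.finrank_add_finrank_dualAnnihilator_eq (LinearMap.range Φ)
  rw [hker, Module.finrank_prod] at h2
  omega

theorem card_commutingBlocks [Finite K] (g A : Module.End K L) (h B : Module.End K U) :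
    Nat.card (commutingBlocks g A h B) =
      Nat.card (U →ₗ[K] L) * Nat.card (intertwiners g A h B) := by
  rw [Module.natCard_eq_pow_finrank (K := K) (V := commutingBlocks g A h B),
    Module.natCard_eq_pow_finrank (K := K) (V := U →ₗ[K] L),
    Module.natCard_eq_pow_finrank (K := K) (V := intertwiners g A h B), finrank_commutingBlocks, pow_add]

end Duality

/-! ### Finiteness -/

section Finiteness
variable {K : Type*} [Field K] [Finite K] {V U : Type*} [AddCommGroup V] [Module K V]
  [AddCommGroup U] [Module K U] [Module.Finite K V] [Module.Finite K U]

instance finite_linearMap : Finite (V →ₗ[K] U) := Module.finite_of_finite K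

instance finite_linearEquiv : Finite (V ≃ₗ[K] U) :=
  Finite.of_injective _ LinearEquiv.toLinearMap_injective

instance finite_submodule : Finite (Submodule K V) :=
  have : Finite V := Module.finite_of_finite K
  Finite.of_injective (fun W : Submodule K V => (W : Set V)) SetLike.coe_injective

end Finiteness

theorem card_sigma_of_const {α : Type*} [Finite α] {β : α → Type*} [∀ a, Finite (β a)] {c : ℕ}
    (h : ∀ a, Nat.card (β a) = c) : Nat.card (Σ a, β a) = Nat.card α * c := by
  have := Fintype.ofFinite α
  rw [Nat.card_sigma, Finset.sum_congr rfl (fun a _ => h a), Finset.sum_const, Finset.card_univ,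
    smul_eq_mul, Nat.card_eq_fintype_card]

/-! ### Block triangular endomorphisms and commuting pairs -/

section BlockEnd
variable {K : Type*} [Field K] {L U : Type*} [AddCommGroup L] [Module K L]
  [AddCommGroup U] [Module K U]

theorem blockEnd_mul (a a' : Module.End K L) (x x' : U →ₗ[K] L) (h h' : Module.End K U) :
    blockEnd a x h * blockEnd a' x' h' = blockEnd (a * a') (a ∘ₗ x' + x ∘ₗ h') (h * h') := by
  ext v <;> simp [blockEnd]

theorem blockEnd_inj {a a' : Module.End K L} {x x' : U →ₗ[K] L} {h h' : Module.End K U} :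
    blockEnd a x h = blockEnd a' x' h' ↔ a = a' ∧ x = x' ∧ h = h' := by
  constructor
  · intro H
    refine ⟨?_, ?_, ?_⟩ <;> ext v
    · simpa [blockEnd] using congrArg Prod.fst (LinearMap.congr_fun H (v, 0))
    · simpa [blockEnd] using congrArg Prod.fst (LinearMap.congr_fun H (0, v))
    · simpa [blockEnd] using congrArg Prod.snd (LinearMap.congr_fun H (0, v))
  · rintro ⟨rfl, rfl, rfl⟩
    rfl

theorem snd_comp_blockEnd (a : Module.End K L) (x : U →ₗ[K] L) (h : Module.End K U) :
    LinearMap.snd K L U ∘ₗ blockEnd a x h = h ∘ₗ LinearMap.snd K L U := rfl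

theorem eq_blockEnd {T : Module.End K (L × U)} {h : Module.End K U}
    (hT : LinearMap.snd K L U ∘ₗ T = h ∘ₗ LinearMap.snd K L U) :
    T = blockEnd (LinearMap.fst K L U ∘ₗ T ∘ₗ LinearMap.inl K L U)
      (LinearMap.fst K L U ∘ₗ T ∘ₗ LinearMap.inr K L U) h := by
  have h2 : ∀ v, (T v).2 = h v.2 := fun v => LinearMap.congr_fun hT v
  have h0 : T (0, 0) = 0 := map_zero T
  ext v <;> simp [blockEnd, h2, h0]

theorem comp_conj_eq_iff {M : Type*} [AddCommGroup M] [Module K M] (e : L ≃ₗ[K] M) (Y : M →ₗ[K] U) (T : Module.End K L)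
    (h : Module.End K U) :
    Y ∘ₗ e.conj T = h ∘ₗ Y ↔
      (Y ∘ₗ e.toLinearMap) ∘ₗ T = h ∘ₗ (Y ∘ₗ e.toLinearMap) := by
  constructor
  · intro H
    ext v
    simpa [LinearEquiv.conj_apply] using LinearMap.congr_fun H (e v)
  · intro H
    ext v
    simpa [LinearEquiv.conj_apply] using LinearMap.congr_fun H (e.symm v)

end BlockEnd

/-- The pairs `(g, A)` of commuting endomorphisms with `g` invertible and `A` in `𝒴_F`. -/
def commPairs {K : Type*} [Field K] (F : Set (AlgebraicClosure K)) (V : Type*) [AddCommGroup V]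
    [Module K V] : Set (Module.End K V × Module.End K V) :=
  {p | IsUnit p.1 ∧ IsClassEnd F p.2 ∧ p.1 * p.2 = p.2 * p.1}

/-- The number of invertible endomorphisms. -/
noncomputable def glCard (K V : Type*) [Field K] [AddCommGroup V] [Module K V] : ℕ :=
  Nat.card {g : Module.End K V // IsUnit g}

/-- Invertible endomorphisms are linear automorphisms. -/
noncomputable def isUnitEquiv (K V : Type*) [Field K] [AddCommGroup V] [Module K V] :
    {g : Module.End K V // IsUnit g} ≃ (V ≃ₗ[K] V) where
  toFun g := LinearEquiv.ofBijective g.1 ((Module.End.isUnit_iff _).1 g.2)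
  invFun e := ⟨e, (Module.End.isUnit_iff _).2 e.bijective⟩
  left_inv _ := rfl
  right_inv e := by ext; rfl

theorem glCard_eq (K V : Type*) [Field K] [AddCommGroup V] [Module K V] :
    glCard K V = Nat.card (V ≃ₗ[K] V) :=
  Nat.card_congr (isUnitEquiv K V)

/-- The number of commuting pairs on `L` together with an intertwining map to `(U, h, B)`. -/
noncomputable def homCount {K : Type*} [Field K] (F : Set (AlgebraicClosure K))
    (L : Type*) [AddCommGroup L] [Module K L] {U : Type*} [AddCommGroup U] [Module K U]
    (h B : Module.End K U) : ℕ :=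
  Nat.card (Σ p : commPairs F L, intertwiners p.1.1 p.1.2 h B)

/-- The number of commuting pairs on `L` together with a surjective intertwining map to
`(U, h, B)`. -/
noncomputable def surjCount {K : Type*} [Field K] (F : Set (AlgebraicClosure K))
    (L : Type*) [AddCommGroup L] [Module K L] {U : Type*} [AddCommGroup U] [Module K U]
    (h B : Module.End K U) : ℕ :=
  Nat.card (Σ p : commPairs F L,
    {Y : intertwiners p.1.1 p.1.2 h B // Function.Surjective Y.1})

/-! ### Counting pairs with a surjective intertwining map -/

section Count
variable {K : Type*} [Field K] {F : Set (AlgebraicClosure K)}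
  {M L U : Type*} [AddCommGroup M] [Module K M]
  [AddCommGroup L] [Module K L] [AddCommGroup U] [Module K U]
  [Module.Finite K M] [Module.Finite K L] [Module.Finite K U]

theorem glCard_pos [Finite K] : 0 < glCard K M := by
  rw [glCard_eq]
  exact Nat.card_pos

/-- The commuting pair on `L × U` with given blocks. -/
def liftOfBlocks {h B : Module.End K U} (hB : (h, B) ∈ commPairs F U)
    (q : Σ p : commPairs F L, commutingBlocks p.1.1 p.1.2 h B) :
    {p : commPairs F (L × U) // LinearMap.snd K L U ∘ₗ p.1.1 = h ∘ₗ LinearMap.snd K L U ∧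
      LinearMap.snd K L U ∘ₗ p.1.2 = B ∘ₗ LinearMap.snd K L U} :=
  ⟨⟨(blockEnd q.1.1.1 q.2.1.1 h, blockEnd q.1.1.2 q.2.1.2 B),
    isUnit_blockEnd_iff.2 ⟨q.1.2.1, hB.1⟩, isClassEnd_blockEnd_iff.2 ⟨q.1.2.2.1, hB.2.1⟩, by
      rw [blockEnd_mul, blockEnd_mul, blockEnd_inj]
      exact ⟨q.1.2.2.2, q.2.2, hB.2.2⟩⟩, snd_comp_blockEnd _ _ _, snd_comp_blockEnd _ _ _⟩

theorem liftOfBlocks_bijective {h B : Module.End K U} (hB : (h, B) ∈ commPairs F U) :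
    Function.Bijective (liftOfBlocks (L := L) hB) := by
  constructor
  · rintro ⟨⟨⟨g, A⟩, hp⟩, ⟨⟨X, Z⟩, hq⟩⟩ ⟨⟨⟨g', A'⟩, hp'⟩, ⟨⟨X', Z'⟩, hq'⟩⟩ H
    have H' : (blockEnd g X h, blockEnd A Z B) = (blockEnd g' X' h, blockEnd A' Z' B) :=
      congrArg (fun p => p.1.1) H
    rw [Prod.mk.injEq, blockEnd_inj, blockEnd_inj] at H'
    obtain ⟨⟨rfl, rfl, -⟩, rfl, rfl, -⟩ := H'
    rfl
  · rintro ⟨⟨⟨g, A⟩, hp⟩, h1, h2⟩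
    have e1 := eq_blockEnd h1
    have e2 := eq_blockEnd h2
    have hp1 := hp.1
    have hp2 := hp.2.1
    have hp3 := hp.2.2
    simp only at e1 e2 hp1 hp2 hp3
    rw [e1] at hp1
    rw [e2] at hp2
    rw [e1, e2, blockEnd_mul, blockEnd_mul, blockEnd_inj] at hp3
    exact ⟨⟨⟨(_, _), (isUnit_blockEnd_iff.1 hp1).1, (isClassEnd_blockEnd_iff.1 hp2).1, hp3.1⟩,
      ⟨(_, _), hp3.2.1⟩⟩, Subtype.ext (Subtype.ext (Prod.ext e1.symm e2.symm))⟩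

/-- The lifts with given diagonal on `L` are the commuting blocks, so duality replaces each fibre by
intertwiners up to a factor independent of the pair on `L`. -/
theorem card_lift [Finite K] {h B : Module.End K U} (hB : (h, B) ∈ commPairs F U) :
    Nat.card {p : commPairs F (L × U) //
        LinearMap.snd K L U ∘ₗ p.1.1 = h ∘ₗ LinearMap.snd K L U ∧
        LinearMap.snd K L U ∘ₗ p.1.2 = B ∘ₗ LinearMap.snd K L U} =
      Nat.card (U →ₗ[K] L) * homCount F L h B := by
  have := Fintype.ofFinite (commPairs F L)
  rw [← Nat.card_eq_of_bijective _ (liftOfBlocks_bijective hB), homCount, Nat.card_sigma, Nat.card_sigma, Finset.mul_sum]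
  exact Finset.sum_congr rfl fun p _ => card_commutingBlocks _ _ _ _

/-- Units of `End (L × U)` that lift `h`, in terms of their blocks. -/
def unitLiftEquiv {h : Module.End K U} (hh : IsUnit h) :
    {g : {g : Module.End K (L × U) // IsUnit g} //
      LinearMap.snd K L U ∘ₗ g.1 = h ∘ₗ LinearMap.snd K L U} ≃
    {a : Module.End K L // IsUnit a} × (U →ₗ[K] L) where
  toFun g := (⟨_, (isUnit_blockEnd_iff.1 (eq_blockEnd g.2 ▸ g.1.2)).1⟩,
    LinearMap.fst K L U ∘ₗ g.1.1 ∘ₗ LinearMap.inr K L U)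
  invFun q := ⟨⟨blockEnd q.1.1 q.2 h, isUnit_blockEnd_iff.2 ⟨q.1.2, hh⟩⟩, snd_comp_blockEnd _ _ _⟩
  left_inv g := Subtype.ext (Subtype.ext (eq_blockEnd g.2).symm)
  right_inv q := by
    obtain ⟨⟨a, ha⟩, x⟩ := q
    ext v <;> simp [blockEnd]

theorem card_unitLift {h : Module.End K U} (hh : IsUnit h) :
    Nat.card {g : {g : Module.End K (L × U) // IsUnit g} //
      LinearMap.snd K L U ∘ₗ g.1 = h ∘ₗ LinearMap.snd K L U} =
    glCard K L * Nat.card (U →ₗ[K] L) := by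
  rw [Nat.card_congr (unitLiftEquiv hh), Nat.card_prod, glCard]

/-- A section splits `Y`, and its kernel has the dimension of `L`; thus every surjection may be
taken to be the projection. -/
theorem exists_equiv_comp_eq_snd (hd : Module.finrank K M = Module.finrank K L + Module.finrank K U)
    {Y : M →ₗ[K] U} (hY : Function.Surjective Y) :
    ∃ e : (L × U) ≃ₗ[K] M, Y ∘ₗ e.toLinearMap = LinearMap.snd K L U := by
  obtain ⟨s, hs⟩ := Y.exists_rightInverse_of_surjective (LinearMap.range_eq_top.2 hY)
  have hs' : ∀ u, Y (s u) = u := fun u => LinearMap.congr_fun hs u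
  have hk : Module.finrank K L = Module.finrank K (LinearMap.ker Y) := by
    have := LinearMap.finrank_range_add_finrank_ker Y
    rw [LinearMap.range_eq_top.2 hY, finrank_top] at this
    omega
  let i := LinearEquiv.ofFinrankEq L (LinearMap.ker Y) hk
  let f : (L × U) →ₗ[K] M := ((LinearMap.ker Y).subtype ∘ₗ i.toLinearMap).coprod s
  have hf : ∀ v, Y (f v) = v.2 := by
    intro v
    have : Y (i v.1 : M) = 0 := (i v.1).2
    simp [f, hs', this]
  have hinj : Function.Injective f := by
    rw [injective_iff_map_eq_zero]
    rintro ⟨l, u⟩ h0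
    have hu : u = 0 := by simpa [h0] using (hf (l, u)).symm
    subst hu
    simpa [f] using h0
  have hd' : Module.finrank K (L × U) = Module.finrank K M := by rw [Module.finrank_prod, hd]
  refine ⟨LinearEquiv.ofBijective f
    ⟨hinj, (LinearMap.injective_iff_surjective_of_finrank_eq_finrank hd').1 hinj⟩, ?_⟩
  ext v
  · exact hf (v, 0)
  · exact hf (0, v)

/-- Transport of commuting pairs along a linear equivalence. -/
def commPairsCongr (e : L ≃ₗ[K] M) : commPairs F L ≃ commPairs F M :=
  (e.conj.toEquiv.prodCongr e.conj.toEquiv).subtypeEquiv fun p => by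
    change _ ↔ IsUnit (e.conjRingEquiv p.1) ∧ IsClassEnd F (e.conj p.2) ∧
      e.conjRingEquiv p.1 * e.conjRingEquiv p.2 = e.conjRingEquiv p.2 * e.conjRingEquiv p.1
    rw [isClassEnd_conj_iff, ← map_mul, ← map_mul, e.conjRingEquiv.injective.eq_iff,
      MulEquiv.isUnit_map]
    rfl

theorem commPairsCongr_coe (e : L ≃ₗ[K] M) (p : commPairs F L) :
    (commPairsCongr e p).1 = (e.conj p.1.1, e.conj p.1.2) := rfl

theorem surjCount_eq [Finite K]
    (hd : Module.finrank K M = Module.finrank K L + Module.finrank K U)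
    {h B : Module.End K U} (hB : (h, B) ∈ commPairs F U) :
    surjCount F M h B = Nat.card {Y : M →ₗ[K] U // Function.Surjective Y} *
      (Nat.card (U →ₗ[K] L) * homCount F L h B) := by
  let E : (Σ p : commPairs F M, {Y : intertwiners p.1.1 p.1.2 h B // Function.Surjective Y.1}) ≃
      Σ Y : {Y : M →ₗ[K] U // Function.Surjective Y},
        {p : commPairs F M // Y.1 ∘ₗ p.1.1 = h ∘ₗ Y.1 ∧ Y.1 ∘ₗ p.1.2 = B ∘ₗ Y.1} :=
    { toFun := fun q => ⟨⟨q.2.1.1, q.2.2⟩, ⟨q.1, q.2.1.2⟩⟩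
      invFun := fun q => ⟨q.2.1, ⟨⟨q.1.1, q.2.2⟩, q.1.2⟩⟩
      left_inv := fun _ => rfl
      right_inv := fun _ => rfl }
  rw [surjCount, Nat.card_congr E]
  refine card_sigma_of_const fun Y => ?_
  obtain ⟨e, he⟩ := exists_equiv_comp_eq_snd (L := L) hd Y.2
  rw [← card_lift hB]
  refine (Nat.card_congr ((commPairsCongr e).subtypeEquiv fun p => ?_)).symm
  rw [commPairsCongr_coe, comp_conj_eq_iff, comp_conj_eq_iff, he]

/-- Automorphisms are fibred over the surjection `snd ∘ e⁻¹`. Each fibre is a coset of the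
automorphisms of `L × U` inducing the identity on `U`. -/
theorem glCard_eq_mul [Finite K]
    (hd : Module.finrank K M = Module.finrank K L + Module.finrank K U) :
    glCard K M = Nat.card {Y : M →ₗ[K] U // Function.Surjective Y} *
      (glCard K L * Nat.card (U →ₗ[K] L)) := by
  have e0 : (L × U) ≃ₗ[K] M := LinearEquiv.ofFinrankEq _ _ (by rw [Module.finrank_prod, hd])
  let f : ((L × U) ≃ₗ[K] M) → {Y : M →ₗ[K] U // Function.Surjective Y} := fun e =>
    ⟨LinearMap.snd K L U ∘ₗ e.symm.toLinearMap, (LinearMap.snd_surjective (R := K) (M := L) (M₂ := U)).comp e.symm.surjective⟩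
  have h1 : glCard K M = Nat.card ((L × U) ≃ₗ[K] M) := by
    rw [glCard_eq]
    exact Nat.card_congr
      ⟨fun e => e0.trans e, fun e => e0.symm.trans e, fun e => by ext; simp, fun e => by ext; simp⟩
  rw [h1, Nat.card_congr (Equiv.sigmaFiberEquiv f).symm]
  refine card_sigma_of_const fun Y => ?_
  obtain ⟨e, he⟩ := exists_equiv_comp_eq_snd (L := L) hd Y.2
  rw [← card_unitLift (h := (1 : Module.End K U)) isUnit_one]
  refine (Nat.card_congr ((((isUnitEquiv K (L × U)).trans
    ⟨fun g => g.trans e, fun g : (L × U) ≃ₗ[K] M => g.trans e.symm, fun g => by ext <;> simp,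
      fun g => by ext <;> simp⟩).subtypeEquiv) fun g => ?_)).symm
  have hg : ∀ v, isUnitEquiv K (L × U) g v = g.1 v := fun _ => rfl
  have hg' : ∀ v, (isUnitEquiv K (L × U) g).symm (g.1 v) = v :=
    (isUnitEquiv K (L × U) g).symm_apply_apply
  have he' : ∀ v, Y.1 (e v) = v.2 := fun v => LinearMap.congr_fun he v
  rw [Subtype.ext_iff]
  constructor
  · intro H
    ext w
    obtain ⟨v, rfl⟩ := ((isUnitEquiv K (L × U) g).trans e).surjective w
    have h2 : (g.1 v).2 = v.2 := LinearMap.congr_fun H v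
    simp [f, hg, he', h2, hg']
  · intro H
    refine LinearMap.ext fun v => ?_
    have h2 := LinearMap.congr_fun H (((isUnitEquiv K (L × U) g).trans e) v)
    simpa [f, hg, he', hg'] using h2.symm

/-- The number of surjections and `|Hom(U, L)|` occur in both counts and cancel. -/
theorem surjCount_mul [Finite K]
    (hd : Module.finrank K M = Module.finrank K L + Module.finrank K U)
    {h B : Module.End K U} (hB : (h, B) ∈ commPairs F U) :
    surjCount F M h B * glCard K L = glCard K M * homCount F L h B := by
  rw [surjCount_eq hd hB, glCard_eq_mul hd]
  ring

end Count

/-- The submodule `W` is invariant under both members of the pair `p`. -/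
def IsInvt {K V : Type*} [Field K] [AddCommGroup V] [Module K V]
    (p : Module.End K V × Module.End K V) (W : Submodule K V) : Prop :=
  (∀ x ∈ W, p.1 x ∈ W) ∧ ∀ x ∈ W, p.2 x ∈ W

/-! ### Sorting intertwining maps by their image -/

section Restrict
variable {K : Type*} [Field K] {F : Set (AlgebraicClosure K)}
  {V M L : Type*} [AddCommGroup V] [Module K V] [AddCommGroup M] [Module K M]
  [AddCommGroup L] [Module K L]

/-- The number of commuting pairs on `M` together with an intertwining map into `W`. -/
noncomputable def homInto (F : Set (AlgebraicClosure K)) (M : Type*) [AddCommGroup M] [Module K M]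
    (p : Module.End K V × Module.End K V) (W : Submodule K V) : ℕ :=
  Nat.card {q : Σ r : commPairs F M, intertwiners r.1.1 r.1.2 p.1 p.2 //
    LinearMap.range q.2.1 ≤ W}

/-- The number of commuting pairs on `M` together with an intertwining map onto `W`. -/
noncomputable def homOnto (F : Set (AlgebraicClosure K)) (M : Type*) [AddCommGroup M] [Module K M]
    (p : Module.End K V × Module.End K V) (W : Submodule K V) : ℕ :=
  Nat.card {q : Σ r : commPairs F M, intertwiners r.1.1 r.1.2 p.1 p.2 //
    LinearMap.range q.2.1 = W}

theorem comp_subtype_intertwines {g : Module.End K M} {h : Module.End K V} {W : Submodule K V}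
    (hW : ∀ x ∈ W, h x ∈ W) (Y : M →ₗ[K] W) :
    (W.subtype ∘ₗ Y) ∘ₗ g = h ∘ₗ (W.subtype ∘ₗ Y) ↔ Y ∘ₗ g = h.restrict hW ∘ₗ Y := by
  simp only [LinearMap.ext_iff, LinearMap.comp_apply, Submodule.subtype_apply, Subtype.ext_iff,
    LinearMap.coe_restrict_apply]

/-- Intertwining maps into an invariant submodule are intertwining maps to the restricted pair. -/
def homIntoEquiv {p : Module.End K V × Module.End K V} {W : Submodule K V} (hW : IsInvt p W) :
    (Σ r : commPairs F M, intertwiners r.1.1 r.1.2 (p.1.restrict hW.1) (p.2.restrict hW.2)) ≃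
    {q : Σ r : commPairs F M, intertwiners r.1.1 r.1.2 p.1 p.2 // LinearMap.range q.2.1 ≤ W} where
  toFun q := ⟨⟨q.1, ⟨W.subtype ∘ₗ q.2.1, (comp_subtype_intertwines hW.1 _).2 q.2.2.1,
      (comp_subtype_intertwines hW.2 _).2 q.2.2.2⟩⟩, by
    rintro _ ⟨x, rfl⟩
    exact (q.2.1 x).2⟩
  invFun q := ⟨q.1.1, ⟨q.1.2.1.codRestrict W fun x => q.2 ⟨x, rfl⟩,
    (comp_subtype_intertwines hW.1 _).1 q.1.2.2.1, (comp_subtype_intertwines hW.2 _).1 q.1.2.2.2⟩⟩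
  left_inv _ := rfl
  right_inv _ := rfl

theorem homInto_eq {p : Module.End K V × Module.End K V} {W : Submodule K V} (hW : IsInvt p W) :
    homInto F M p W = homCount F M (p.1.restrict hW.1) (p.2.restrict hW.2) :=
  (Nat.card_congr (homIntoEquiv hW)).symm

theorem homOnto_eq {p : Module.End K V × Module.End K V} {W : Submodule K V} (hW : IsInvt p W) :
    homOnto F M p W = surjCount F M (p.1.restrict hW.1) (p.2.restrict hW.2) := by
  let E : (Σ r : commPairs F M, {Y : intertwiners r.1.1 r.1.2 (p.1.restrict hW.1)
        (p.2.restrict hW.2) // Function.Surjective Y.1}) ≃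
      {q : Σ r : commPairs F M, intertwiners r.1.1 r.1.2 (p.1.restrict hW.1)
        (p.2.restrict hW.2) // Function.Surjective q.2.1} :=
    ⟨fun q => ⟨⟨q.1, q.2.1⟩, q.2.2⟩, fun q => ⟨q.1.1, ⟨q.1.2, q.2⟩⟩, fun _ => rfl, fun _ => rfl⟩
  let E' : {q : {q : Σ r : commPairs F M, intertwiners r.1.1 r.1.2 p.1 p.2 //
        LinearMap.range q.2.1 ≤ W} // LinearMap.range q.1.2.1 = W} ≃
      {q : Σ r : commPairs F M, intertwiners r.1.1 r.1.2 p.1 p.2 // LinearMap.range q.2.1 = W} :=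
    ⟨fun q => ⟨q.1.1, q.2⟩, fun q => ⟨⟨q.1, q.2.le⟩, q.2⟩, fun _ => rfl, fun _ => rfl⟩
  refine ((Nat.card_congr E).trans ((Nat.card_congr
    ((homIntoEquiv hW).subtypeEquiv fun q => ?_)).trans (Nat.card_congr E'))).symm
  rw [← LinearMap.range_eq_top]
  change _ ↔ LinearMap.range (W.subtype ∘ₗ q.2.1) = W
  rw [LinearMap.range_comp]
  constructor
  · intro h
    rw [h, Submodule.map_subtype_top]
  · intro h
    apply Submodule.map_injective_of_injective W.injective_subtype
    rw [h, Submodule.map_subtype_top]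

theorem restrict_mem_commPairs [Module.Finite K V] {p : Module.End K V × Module.End K V}
    (hp : p ∈ commPairs F V) {W : Submodule K V} (hW : IsInvt p W) :
    (p.1.restrict hW.1, p.2.restrict hW.2) ∈ commPairs F W := by
  refine ⟨?_, ?_, ?_⟩
  · rw [isUnit_iff_isClassEnd]
    exact (isUnit_iff_isClassEnd.1 hp.1).of_injective W.injective_subtype (by ext; rfl)
  · exact hp.2.1.of_injective W.injective_subtype (by ext; rfl)
  · ext x
    exact LinearMap.congr_fun hp.2.2 x

theorem isInvt_range {r : Module.End K M × Module.End K M} {p : Module.End K V × Module.End K V}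
    (Y : intertwiners r.1 r.2 p.1 p.2) : IsInvt p (LinearMap.range Y.1) := by
  constructor
  · rintro _ ⟨x, rfl⟩
    exact ⟨r.1 x, LinearMap.congr_fun Y.2.1 x⟩
  · rintro _ ⟨x, rfl⟩
    exact ⟨r.2 x, LinearMap.congr_fun Y.2.2 x⟩

/-- This is the recursion step: fixing the image `W` lowers the dimension of the source by `dim W`,
and the new maps land in `W` again. -/
theorem homOnto_mul [Finite K] [Module.Finite K V] [Module.Finite K M] [Module.Finite K L]
    {p : Module.End K V × Module.End K V} (hp : p ∈ commPairs F V)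
    {W : Submodule K V} (hW : IsInvt p W)
    (hd : Module.finrank K M = Module.finrank K L + Module.finrank K W) :
    homOnto F M p W * glCard K L = glCard K M * homInto F L p W := by
  rw [homOnto_eq hW, homInto_eq hW]
  exact surjCount_mul hd (restrict_mem_commPairs hp hW)

theorem homOnto_eq_zero [Module.Finite K M] {p : Module.End K V × Module.End K V}
    {W : Submodule K V} (hd : Module.finrank K M < Module.finrank K W) :
    homOnto F M p W = 0 := by
  rw [homOnto, Nat.card_eq_zero]
  left
  constructor
  rintro ⟨q, hq⟩
  have := LinearMap.finrank_range_le q.2.1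
  rw [hq] at this
  omega

theorem homInto_bot (p : Module.End K V × Module.End K V) :
    homInto F M p ⊥ = Nat.card (commPairs F M) := by
  refine Nat.card_congr ⟨fun q => q.1.1, fun r => ⟨⟨r, 0⟩, by simp⟩, ?_, fun _ => rfl⟩
  rintro ⟨⟨r, Y⟩, hY⟩
  have : Y = 0 := by
    apply Subtype.ext
    rw [le_bot_iff, LinearMap.range_eq_bot] at hY
    exact hY
  subst this
  rfl

open Classical in
theorem homInto_eq_sum [Finite K] [Module.Finite K V] [Module.Finite K M] [Fintype (Submodule K V)]
    (p : Module.End K V × Module.End K V) (U : Submodule K V) :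
    homInto F M p U =
      ∑ W ∈ Finset.univ.filter (fun W => W ≤ U ∧ IsInvt p W), homOnto F M p W := by
  let E : {q : Σ r : commPairs F M, intertwiners r.1.1 r.1.2 p.1 p.2 // LinearMap.range q.2.1 ≤ U} ≃
      Σ W : {W : Submodule K V // W ≤ U ∧ IsInvt p W},
        {q : Σ r : commPairs F M, intertwiners r.1.1 r.1.2 p.1 p.2 //
          LinearMap.range q.2.1 = W.1} :=
    { toFun := fun q => ⟨⟨LinearMap.range q.1.2.1, q.2, isInvt_range q.1.2⟩, ⟨q.1, rfl⟩⟩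
      invFun := fun q => ⟨q.2.1, q.2.2.le.trans q.1.2.1⟩
      left_inv := fun _ => rfl
      right_inv := by
        rintro ⟨⟨W, hW⟩, ⟨q, hq⟩⟩
        change _ = W at hq
        subst hq
        rfl }
  rw [homInto, Nat.card_congr E, Nat.card_sigma]
  exact (Finset.sum_subtype _ (fun W => by simp) fun W => homOnto F M p W).symm

end Restrict

/-! ### Invariant flags -/

section Flags
variable {K : Type*} [Field K] {V : Type*} [AddCommGroup V] [Module K V]

/-- The descending lists of submodules of `U` that are invariant under `p` and have the prescribed
dimensions. -/
def flagsIn (p : Module.End K V × Module.End K V) (U : Submodule K V) (s : List ℕ) :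
    Set (List (Submodule K V)) :=
  {c | c.map (fun W : Submodule K V => Module.finrank K W) = s ∧ c.Pairwise (· ≥ ·) ∧ ∀ W ∈ c, W ≤ U ∧ IsInvt p W}

theorem finite_flagsIn [Finite K] [Module.Finite K V] (p : Module.End K V × Module.End K V)
    (U : Submodule K V) (s : List ℕ) : (flagsIn p U s).Finite := by
  refine (List.finite_length_eq (Submodule K V) s.length).subset fun c hc => ?_
  rw [Set.mem_ofPred_eq, ← hc.1, List.length_map]

theorem card_flagsIn_nil (p : Module.End K V × Module.End K V) (U : Submodule K V) :
    Nat.card (flagsIn p U []) = 1 := by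
  have : flagsIn p U [] = {[]} := by
    ext c
    constructor
    · intro hc
      exact List.map_eq_nil_iff.1 hc.1
    · rintro rfl
      simp [flagsIn]
  rw [this]
  simp

open Classical in
theorem card_flagsIn_cons [Finite K] [Module.Finite K V] [Fintype (Submodule K V)]
    (p : Module.End K V × Module.End K V) (U : Submodule K V) (d : ℕ) (s : List ℕ) :
    Nat.card (flagsIn p U (d :: s)) =
      ∑ W ∈ Finset.univ.filter (fun W => (W ≤ U ∧ IsInvt p W) ∧ Module.finrank K W = d),
        Nat.card (flagsIn p W s) := by
  have hfin : ∀ W, Finite (flagsIn p W s) := fun W => finite_flagsIn p W s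
  let f : (Σ W : {W : Submodule K V // (W ≤ U ∧ IsInvt p W) ∧ Module.finrank K W = d},
      flagsIn p W.1 s) → flagsIn p U (d :: s) := fun q => ⟨q.1.1 :: q.2.1, by
    obtain ⟨⟨W, hW⟩, ⟨c, hc⟩⟩ := q
    refine ⟨by simp [hW.2, hc.1], List.pairwise_cons.2 ⟨fun W' h => (hc.2.2 W' h).1, hc.2.1⟩, ?_⟩
    intro W' hW'
    rcases List.mem_cons.1 hW' with rfl | h
    · exact hW.1
    · exact ⟨(hc.2.2 _ h).1.trans hW.1.1, (hc.2.2 _ h).2⟩⟩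
  have hf : Function.Bijective f := by
    constructor
    · rintro ⟨⟨W, hW⟩, ⟨c, hc⟩⟩ ⟨⟨W', hW'⟩, ⟨c', hc'⟩⟩ H
      have H' : W :: c = W' :: c' := congrArg Subtype.val H
      rw [List.cons_eq_cons] at H'
      obtain ⟨rfl, rfl⟩ := H'
      rfl
    · rintro ⟨c, hc⟩
      cases c with
      | nil => exact absurd hc.1 (by simp)
      | cons W c =>
        obtain ⟨h1, h2, h3⟩ := hc
        rw [List.map_cons, List.cons_eq_cons] at h1
        rw [List.pairwise_cons] at h2
        exact ⟨⟨⟨W, h3 W List.mem_cons_self, h1.1⟩, ⟨c, h1.2, h2.2,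
          fun W' h => ⟨h2.1 W' h, (h3 W' (List.mem_cons_of_mem _ h)).2⟩⟩⟩, rfl⟩
  rw [← Nat.card_eq_of_bijective f hf, Nat.card_sigma]
  exact (Finset.sum_subtype _ (fun W => by simp) fun W => Nat.card (flagsIn p W s)).symm

end Flags

/-! ### Lists of positive integers of bounded sum -/

/-- The lists of positive integers with sum at most `k`. -/
def posLists (k : ℕ) : Finset (List ℕ) :=
  insert [] (Finset.univ.biUnion fun i : Fin k =>
    (posLists (k - (i + 1))).image (List.cons (i.1 + 1)))
termination_by k
decreasing_by have := i.2; omega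

theorem mem_posLists {k : ℕ} {l : List ℕ} : l ∈ posLists k ↔ (∀ x ∈ l, 0 < x) ∧ l.sum ≤ k := by
  induction l generalizing k with
  | nil => rw [posLists]; simp
  | cons d s ih =>
    rw [posLists]
    simp only [Finset.mem_insert, reduceCtorEq, false_or, Finset.mem_biUnion, Finset.mem_univ,
      true_and, Finset.mem_image, List.cons_eq_cons, List.mem_cons, forall_eq_or_imp,
      List.sum_cons]
    constructor
    · rintro ⟨i, a, ha, rfl, rfl⟩
      obtain ⟨h1, h2⟩ := ih.1 ha
      have := i.2
      exact ⟨⟨by omega, h1⟩, by omega⟩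
    · rintro ⟨⟨h1, h2⟩, h3⟩
      exact ⟨⟨d - 1, by omega⟩, s, ih.2 ⟨h2, by simp only; omega⟩, by simp only; omega, rfl⟩

theorem sum_posLists {R : Type*} [AddCommMonoid R] (k : ℕ) (f : List ℕ → R) :
    ∑ l ∈ posLists k, f l =
      f [] + ∑ i : Fin k, ∑ s ∈ posLists (k - (i + 1)), f ((i.1 + 1) :: s) := by
  rw [posLists, Finset.sum_insert (by simp), Finset.sum_biUnion]
  · congr 1
    refine Finset.sum_congr rfl fun i _ => Finset.sum_image ?_
    intro a _ b _ h
    exact (List.cons_eq_cons.1 h).2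
  · intro i _ j _ hij
    rw [Function.onFun, Finset.disjoint_left]
    intro l h1 h2
    obtain ⟨a, -, rfl⟩ := Finset.mem_image.1 h1
    obtain ⟨b, -, h⟩ := Finset.mem_image.1 h2
    apply hij
    have := (List.cons_eq_cons.1 h).1
    exact Fin.ext (by omega)

/-! ### Iterating the recursion -/

section Unroll
variable {K : Type*} [Field K] [Finite K] {F : Set (AlgebraicClosure K)}
  {V : Type*} [AddCommGroup V] [Module K V] [Module.Finite K V]

/-- Strong induction on `k`: the image `W` becomes the head of the flag, and the remaining maps from
dimension `k - dim W` into `W` produce its tail. The recursion stops at image zero, which leaves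
only a commuting pair on the remaining space. -/
theorem homInto_div_eq_sum {p : Module.End K V × Module.End K V} (hp : p ∈ commPairs F V)
    (k : ℕ) (U : Submodule K V) :
    (homInto F (Fin k → K) p U : ℚ) / glCard K (Fin k → K) =
      ∑ s ∈ posLists k, (Nat.card (commPairs F (Fin (k - s.sum) → K)) : ℚ) /
        glCard K (Fin (k - s.sum) → K) * Nat.card (flagsIn p U s) := by
  classical
  have := Fintype.ofFinite (Submodule K V)
  induction k using Nat.strong_induction_on generalizing U with
  | _ k ih =>
  have hG : ∀ n, (glCard K (Fin n → K) : ℚ) ≠ 0 := fun n => by exact_mod_cast glCard_pos.ne'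
  let S := Finset.univ.filter (fun W : Submodule K V => W ≤ U ∧ IsInvt p W)
  have hstep : ∀ W ∈ S, Module.finrank K W ≤ k →
      (homOnto F (Fin k → K) p W : ℚ) / glCard K (Fin k → K) =
        homInto F (Fin (k - Module.finrank K W) → K) p W /
          glCard K (Fin (k - Module.finrank K W) → K) := by
    intro W hW hd
    rw [div_eq_div_iff (hG _) (hG _)]
    have := homOnto_mul (M := Fin k → K) (L := Fin (k - Module.finrank K W) → K) hp
      (Finset.mem_filter.1 hW).2.2 (by rw [Module.finrank_fin_fun, Module.finrank_fin_fun]; omega)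
    rw [mul_comm (homInto _ _ _ _ : ℚ)]
    exact_mod_cast this
  have hsplit : (homInto F (Fin k → K) p U : ℚ) / glCard K (Fin k → K) =
      ∑ d ∈ Finset.range (k + 1), ∑ W ∈ S.filter (fun W : Submodule K V => Module.finrank K W = d),
        (homInto F (Fin (k - d) → K) p W : ℚ) / glCard K (Fin (k - d) → K) := by
    rw [homInto_eq_sum, Nat.cast_sum, Finset.sum_div]
    have h1 : ∑ W ∈ S, (homOnto F (Fin k → K) p W : ℚ) / glCard K (Fin k → K) =
        ∑ W ∈ S.filter (fun W : Submodule K V => Module.finrank K W ∈ Finset.range (k + 1)),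
          (homOnto F (Fin k → K) p W : ℚ) / glCard K (Fin k → K) := by
      refine (Finset.sum_filter_of_ne fun W _ h0 => ?_).symm
      by_contra h
      refine h0 ?_
      rw [homOnto_eq_zero, Nat.cast_zero, zero_div]
      rw [Module.finrank_fin_fun]
      simpa using h
    refine h1.trans ?_
    refine (Finset.sum_fiberwise_of_maps_to (t := Finset.range (k + 1))
      (g := fun W : Submodule K V => Module.finrank K W)
      (fun W hW => (Finset.mem_filter.1 hW).2) _).symm.trans ?_
    refine Finset.sum_congr rfl fun d hd => ?_
    rw [Finset.filter_filter]
    refine Finset.sum_congr ?_ fun W hW => ?_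
    · ext W
      simp only [Finset.mem_filter]
      constructor
      · rintro ⟨h1, -, h2⟩
        exact ⟨h1, h2⟩
      · rintro ⟨h1, rfl⟩
        exact ⟨h1, hd, rfl⟩
    · obtain ⟨h1, rfl⟩ := Finset.mem_filter.1 hW
      exact hstep W h1 (Nat.lt_succ_iff.1 (Finset.mem_range.1 hd))
  -- Dimension `0` gives the empty list, since its only subspace is `⊥`; dimension `i + 1` is the
  -- head of a nonempty list.
  rw [hsplit, Finset.sum_range_succ', sum_posLists, add_comm]
  congr 1
  · have hbot : S.filter (fun W : Submodule K V => Module.finrank K W = 0) = {⊥} := by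
      ext W
      simp only [S, Finset.mem_filter, Finset.mem_univ, true_and, Finset.mem_singleton,
        Submodule.finrank_eq_zero]
      constructor
      · exact fun h => h.2
      · rintro rfl
        refine ⟨⟨bot_le, ?_, ?_⟩, rfl⟩ <;> simp
    rw [hbot, Finset.sum_singleton, homInto_bot, card_flagsIn_nil, Nat.cast_one,
      mul_one]
    rfl
  · rw [← Fin.sum_univ_eq_sum_range (fun d => ∑ W ∈ S.filter (fun W : Submodule K V => Module.finrank K W = d + 1),
        (homInto F (Fin (k - (d + 1)) → K) p W : ℚ) / glCard K (Fin (k - (d + 1)) → K))]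
    refine Finset.sum_congr rfl fun i _ => ?_
    simp only [card_flagsIn_cons, Nat.cast_sum, Finset.mul_sum, List.sum_cons]
    rw [Finset.sum_comm]
    refine Finset.sum_congr (by rw [Finset.filter_filter]) fun W _ => ?_
    rw [ih _ (by have := i.2; omega)]
    refine Finset.sum_congr rfl fun s _ => ?_
    rw [Nat.sub_sub]
    rfl

end Unroll

/-! ### Transitivity on flags -/

section Transitivity

theorem exists_equiv_extend {K V V' : Type*} [Field K] [AddCommGroup V] [Module K V]
    [AddCommGroup V'] [Module K V'] [Module.Finite K V] [Module.Finite K V']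
    (hd : Module.finrank K V = Module.finrank K V') {U : Submodule K V} {U' : Submodule K V'}
    (e : U ≃ₗ[K] U') : ∃ f : V ≃ₗ[K] V', ∀ x : U, f x = e x := by
  obtain ⟨C, hC⟩ := U.exists_isCompl
  obtain ⟨C', hC'⟩ := U'.exists_isCompl
  have h1 := Submodule.finrank_add_eq_of_isCompl hC
  have h2 := Submodule.finrank_add_eq_of_isCompl hC'
  have h3 := e.finrank_eq
  let e' : C ≃ₗ[K] C' := LinearEquiv.ofFinrankEq _ _ (by omega)
  refine ⟨(U.prodEquivOfIsCompl C hC).symm.trans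
    ((e.prodCongr e').trans (U'.prodEquivOfIsCompl C' hC')), fun x => ?_⟩
  simp

theorem flag_comap_subtype {K V : Type*} [Field K] [AddCommGroup V] [Module K V]
    (U : Submodule K V) (t : List (Submodule K V)) {s : List ℕ} (hU : ∀ W ∈ t, U ≥ W)
    (hp : t.Pairwise (· ≥ ·)) (hs : t.map (fun W : Submodule K V => Module.finrank K W) = s) :
    (t.map (Submodule.comap U.subtype)).map (fun W : Submodule K U => Module.finrank K W) = s ∧
      (t.map (Submodule.comap U.subtype)).Pairwise (· ≥ ·) := by
  constructor
  · rw [← hs, List.map_map]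
    refine List.map_congr_left fun W hW => ?_
    exact (Submodule.comapSubtypeEquivOfLe (hU W hW)).finrank_eq
  · rw [List.pairwise_map]
    exact hp.imp fun h => Submodule.comap_mono h

/-- The largest member serves as the new ambient space: an isomorphism matching the tails inside `U`
and `U'` extends to `V` along complements. The spaces are quantified after `s` because they change
in the induction. -/
theorem exists_equiv_map_eq {K : Type*} [Field K] (s : List ℕ) :
    ∀ {V V' : Type*} [AddCommGroup V] [Module K V] [AddCommGroup V'] [Module K V']
      [Module.Finite K V] [Module.Finite K V'] (_ : Module.finrank K V = Module.finrank K V')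
      (c : List (Submodule K V)) (c' : List (Submodule K V')),
      c.map (fun W : Submodule K V => Module.finrank K W) = s →
      c'.map (fun W : Submodule K V' => Module.finrank K W) = s →
      c.Pairwise (· ≥ ·) → c'.Pairwise (· ≥ ·) →
      ∃ e : V ≃ₗ[K] V', c.map (Submodule.map e.toLinearMap) = c' := by
  induction s with
  | nil =>
    intro V V' _ _ _ _ _ _ hd c c' h h' _ _
    rw [List.map_eq_nil_iff] at h h'
    subst h h'
    exact ⟨LinearEquiv.ofFinrankEq _ _ hd, rfl⟩
  | cons d s ih =>
    intro V V' _ _ _ _ _ _ hd c c' h h' hc hc'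
    rw [List.map_eq_cons_iff] at h h'
    obtain ⟨U, t, rfl, hU, ht⟩ := h
    obtain ⟨U', t', rfl, hU', ht'⟩ := h'
    rw [List.pairwise_cons] at hc hc'
    obtain ⟨a1, a2⟩ := flag_comap_subtype U t hc.1 hc.2 ht
    obtain ⟨b1, b2⟩ := flag_comap_subtype U' t' hc'.1 hc'.2 ht'
    obtain ⟨e, he⟩ := ih (hU.trans hU'.symm) _ _ a1 b1 a2 b2
    obtain ⟨f, hf⟩ := exists_equiv_extend hd e
    have hsub : f.toLinearMap ∘ₗ U.subtype = U'.subtype ∘ₗ e.toLinearMap := LinearMap.ext hf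
    have hmap : ∀ W : Submodule K U, (W.map U.subtype).map f.toLinearMap =
        (W.map e.toLinearMap).map U'.subtype := by
      intro W
      rw [← Submodule.map_comp, hsub, Submodule.map_comp]
    refine ⟨f, ?_⟩
    rw [List.map_cons, List.cons_eq_cons]
    constructor
    · have := hmap ⊤
      rwa [Submodule.map_subtype_top, Submodule.map_top, LinearEquiv.range,
        Submodule.map_subtype_top] at this
    · have h1 : t'.map (Submodule.map U'.subtype ∘ Submodule.comap U'.subtype) = t' := by
        refine (List.map_congr_left fun W hW => ?_).trans (List.map_id t')
        simp only [Function.comp, id, Submodule.map_comap_subtype]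
        exact inf_eq_right.2 (hc'.1 W hW)
      rw [← h1, ← List.map_map, ← he, List.map_map, List.map_map]
      refine List.map_congr_left fun W hW => ?_
      simp only [Function.comp]
      rw [← hmap, Submodule.map_comap_subtype, inf_eq_right.2 (hc.1 W hW)]

end Transitivity

/-! ### Orbit-stabilizer counts for flags -/

section FlagCount
variable {K : Type*} [Field K] {V V' : Type*} [AddCommGroup V] [Module K V]
  [AddCommGroup V'] [Module K V']

/-- The commuting pairs that preserve all members of the list `c`. -/
def flagPairs (F : Set (AlgebraicClosure K)) (c : List (Submodule K V)) :
    Set (Module.End K V × Module.End K V) :=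
  {p | p ∈ commPairs F V ∧ ∀ W ∈ c, IsInvt p W}

/-- The invertible endomorphisms that preserve all members of the list `c`. -/
def flagStab (c : List (Submodule K V)) : Set (Module.End K V) :=
  {g | IsUnit g ∧ ∀ W ∈ c, ∀ x ∈ W, g x ∈ W}

/-- Commuting pairs that preserve `c`, as a subtype of the commuting pairs. -/
def flagPairsEquiv (F : Set (AlgebraicClosure K)) (c : List (Submodule K V)) :
    flagPairs F c ≃ {p : commPairs F V // ∀ W ∈ c, IsInvt p.1 W} where
  toFun p := ⟨⟨p.1, p.2.1⟩, p.2.2⟩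
  invFun p := ⟨p.1.1, p.1.2, p.2⟩
  left_inv _ := rfl
  right_inv _ := rfl

theorem isInvt_conj_iff (e : V ≃ₗ[K] V') (p : Module.End K V × Module.End K V)
    (W : Submodule K V) :
    IsInvt (e.conj p.1, e.conj p.2) (W.map e.toLinearMap) ↔ IsInvt p W := by
  have key : ∀ T : Module.End K V,
      (∀ x ∈ W.map e.toLinearMap, e.conj T x ∈ W.map e.toLinearMap) ↔ ∀ x ∈ W, T x ∈ W := by
    intro T
    constructor
    · intro H x hx
      obtain ⟨y, hy, hxy⟩ := H (e x) ⟨x, hx, rfl⟩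
      have : y = T x := by simpa [LinearEquiv.conj_apply] using hxy
      exact this ▸ hy
    · rintro H _ ⟨x, hx, rfl⟩
      exact ⟨T x, H x hx, by simp [LinearEquiv.conj_apply]⟩
  exact and_congr (key _) (key _)

variable [Module.Finite K V]

/-- Precomposition with automorphisms makes these isomorphisms a torsor under the stabilizer of `c`.
Preserving `W` is the same as mapping it onto itself, by dimension. -/
theorem card_equiv_map_eq (e : V ≃ₗ[K] V') (c : List (Submodule K V)) :
    Nat.card {f : V ≃ₗ[K] V' //
      c.map (Submodule.map f.toLinearMap) = c.map (Submodule.map e.toLinearMap)} =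
    Nat.card (flagStab c) := by
  let E : flagStab c ≃ {g : {g : Module.End K V // IsUnit g} // ∀ W ∈ c, ∀ x ∈ W, g.1 x ∈ W} :=
    ⟨fun p => ⟨⟨p.1, p.2.1⟩, p.2.2⟩, fun p => ⟨p.1.1, p.1.2, p.2⟩, fun _ => rfl, fun _ => rfl⟩
  rw [Nat.card_congr E]
  refine (Nat.card_congr ((((isUnitEquiv K V).trans
    ⟨fun g => g.trans e, fun g : V ≃ₗ[K] V' => g.trans e.symm, fun g => by ext; simp,
      fun g => by ext; simp⟩).subtypeEquiv) fun g => ?_)).symm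
  rw [List.map_inj_left]
  refine forall₂_congr fun W _ => ?_
  have h1 : W.map (((isUnitEquiv K V) g).trans e).toLinearMap =
      (W.map ((isUnitEquiv K V) g).toLinearMap).map e.toLinearMap := by
    rw [LinearEquiv.coe_trans, Submodule.map_comp]
  change _ ↔ W.map (((isUnitEquiv K V) g).trans e).toLinearMap = _
  rw [h1, (Submodule.map_injective_of_injective e.injective).eq_iff]
  constructor
  · intro H
    apply Submodule.eq_of_le_of_finrank_eq
    · rintro _ ⟨x, hx, rfl⟩
      exact H x hx
    · exact LinearEquiv.finrank_map_eq ((isUnitEquiv K V) g) W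
  · intro H x hx
    have : g.1 x ∈ W.map ((isUnitEquiv K V) g).toLinearMap := ⟨x, hx, rfl⟩
    rwa [H] at this

variable [Module.Finite K V']

theorem card_flagPairs_map {F : Set (AlgebraicClosure K)} (e : V ≃ₗ[K] V')
    (c : List (Submodule K V)) :
    Nat.card (flagPairs F (c.map (Submodule.map e.toLinearMap))) = Nat.card (flagPairs F c) := by
  rw [Nat.card_congr (flagPairsEquiv F _), Nat.card_congr (flagPairsEquiv F c)]
  refine (Nat.card_congr ((commPairsCongr e).subtypeEquiv fun p => ?_)).symm
  simp only [List.forall_mem_map]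
  exact forall₂_congr fun W _ => (isInvt_conj_iff e p.1 W).symm

/-- Both the isomorphisms `V ≃ V'` and the pairs with an invariant flag are fibred over the flags of
this type in `V'`. By transitivity the fibres have constant size, and the number of flags cancels.
-/
theorem card_flagPairs_mul [Finite K] {F : Set (AlgebraicClosure K)}
    (hd : Module.finrank K V = Module.finrank K V') {c : List (Submodule K V)}
    (hc : c.Pairwise (· ≥ ·)) :
    Nat.card (flagPairs F c) * glCard K V' = Nat.card (flagStab c) *
      Nat.card (Σ p : commPairs F V',
        flagsIn p.1 ⊤ (c.map fun W : Submodule K V => Module.finrank K W)) := by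
  let s := c.map fun W : Submodule K V => Module.finrank K W
  let T : Set (List (Submodule K V')) :=
    {c' | c'.map (fun W : Submodule K V' => Module.finrank K W) = s ∧ c'.Pairwise (· ≥ ·)}
  have hT : Finite T := by
    refine Set.Finite.subset (List.finite_length_eq (Submodule K V') s.length) fun c' hc' => ?_
    have h := congrArg List.length hc'.1
    rwa [List.length_map] at h
  have hex : ∀ c' : T, ∃ e : V ≃ₗ[K] V', c.map (Submodule.map e.toLinearMap) = c'.1 :=
    fun c' => exists_equiv_map_eq s hd c c'.1 rfl c'.2.1 hc c'.2.2
  let f : (V ≃ₗ[K] V') → T := fun e => ⟨c.map (Submodule.map e.toLinearMap), by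
    constructor
    · rw [List.map_map]
      exact List.map_congr_left fun W _ => LinearEquiv.finrank_map_eq e W
    · rw [List.pairwise_map]
      exact hc.imp fun h => Submodule.map_mono h⟩
  have e0 : V' ≃ₗ[K] V := LinearEquiv.ofFinrankEq _ _ hd.symm
  have h1 : glCard K V' = Nat.card T * Nat.card (flagStab c) := by
    have : glCard K V' = Nat.card (V ≃ₗ[K] V') := by
      rw [glCard_eq]
      exact Nat.card_congr ⟨fun e => e0.symm.trans e, fun e => e0.trans e,
        fun e => by ext; simp, fun e => by ext; simp⟩
    rw [this, Nat.card_congr (Equiv.sigmaFiberEquiv f).symm]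
    refine card_sigma_of_const fun c' => ?_
    obtain ⟨e, he⟩ := hex c'
    rw [← card_equiv_map_eq e c, he]
    exact Nat.card_congr (Equiv.subtypeEquivRight fun g => Subtype.ext_iff)
  have h2 : Nat.card (Σ p : commPairs F V', flagsIn p.1 ⊤ s) =
      Nat.card T * Nat.card (flagPairs F c) := by
    let E : (Σ p : commPairs F V', flagsIn p.1 ⊤ s) ≃ Σ c' : T, flagPairs F c'.1 :=
      { toFun := fun q => ⟨⟨q.2.1, q.2.2.1, q.2.2.2.1⟩,
          ⟨q.1.1, q.1.2, fun W hW => (q.2.2.2.2 W hW).2⟩⟩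
        invFun := fun q => ⟨⟨q.2.1, q.2.2.1⟩,
          ⟨q.1.1, q.1.2.1, q.1.2.2, fun W hW => ⟨le_top, q.2.2.2 W hW⟩⟩⟩
        left_inv := fun _ => rfl
        right_inv := fun _ => rfl }
    rw [Nat.card_congr E]
    refine card_sigma_of_const fun c' => ?_
    obtain ⟨e, he⟩ := hex c'
    rw [← he, card_flagPairs_map]
  rw [h1, h2]
  ring

end FlagCount

/-! ### Burnside's lemma for conjugation of matrices -/

theorem orbitCount_mul_card (G X : Type*) [Group G] [MulAction G X] :
    orbitCount G X * Nat.card G = Nat.card (Σ g : G, MulAction.fixedBy X g) := by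
  rw [Nat.card_congr (MulAction.sigmaFixedByEquivOrbitsProdGroup G X), Nat.card_prod]
  rfl

section MatrixCount
variable {K : Type*} [Field K] {ι : Type*} [Fintype ι] [DecidableEq ι]

theorem isUnit_toLin' (g : GL ι K) : IsUnit (Matrix.toLin' g.val : Module.End K (ι → K)) :=
  g.isUnit.map (Matrix.toLinAlgEquiv' (R := K) (n := ι))

theorem exists_toLin'_eq {T : Module.End K (ι → K)} (hT : IsUnit T) :
    ∃ g : GL ι K, Matrix.toLin' g.val = T := by
  obtain ⟨g, hg⟩ := hT.map (LinearMap.toMatrixAlgEquiv' (R := K) (n := ι))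
  refine ⟨g, ?_⟩
  rw [hg]
  exact Matrix.toLin'_toMatrix' T

theorem conjAct_smul_eq_iff (g : ConjAct (GL ι K)) (A : Matrix ι ι K) :
    g • A = A ↔ (Matrix.toLin' (ConjAct.ofConjAct g).val : Module.End K (ι → K)) *
      Matrix.toLin' A = Matrix.toLin' A * Matrix.toLin' (ConjAct.ofConjAct g).val := by
  rw [ConjAct.units_smul_def, Units.mul_inv_eq_iff_eq_mul, Module.End.mul_eq_comp,
    Module.End.mul_eq_comp, ← Matrix.toLin'_mul, ← Matrix.toLin'_mul, Matrix.toLin'.injective.eq_iff]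

theorem card_conjAct : Nat.card (ConjAct (GL ι K)) = glCard K (ι → K) := by
  refine Nat.card_eq_of_bijective
    (fun g => (⟨Matrix.toLin' (ConjAct.ofConjAct g).val, isUnit_toLin' _⟩ :
      {g : Module.End K (ι → K) // IsUnit g})) ⟨?_, ?_⟩
  · intro g g' h
    exact Units.ext (Matrix.toLin'.injective (congrArg Subtype.val h))
  · rintro ⟨T, hT⟩
    obtain ⟨g, hg⟩ := exists_toLin'_eq hT
    exact ⟨ConjAct.toConjAct g, Subtype.ext hg⟩

theorem classCount_mul_glCard (F : Set (AlgebraicClosure K)) (n : ℕ) :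
    classCount F n * glCard K (Fin n → K) = Nat.card (commPairs F (Fin n → K)) := by
  rw [classCount, ← card_conjAct, orbitCount_mul_card]
  refine Nat.card_eq_of_bijective
    (fun q => (⟨(Matrix.toLin' (ConjAct.ofConjAct q.1).val, Matrix.toLin' q.2.1.1),
      isUnit_toLin' _, q.2.1.2,
      (conjAct_smul_eq_iff _ _).1 (congrArg Subtype.val q.2.2)⟩ :
      commPairs F (Fin n → K))) ⟨?_, ?_⟩
  · rintro ⟨g, ⟨A, hA⟩, hg⟩ ⟨g', ⟨A', hA'⟩, hg'⟩ h
    have h' := Prod.ext_iff.1 (congrArg Subtype.val h)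
    obtain rfl : g = g' := Units.ext (Matrix.toLin'.injective h'.1)
    obtain rfl : A = A' := Matrix.toLin'.injective h'.2
    rfl
  · rintro ⟨⟨T, S⟩, hT, hS, hTS⟩
    obtain ⟨g, rfl⟩ := exists_toLin'_eq hT
    obtain ⟨A, rfl⟩ := Matrix.toLin'.surjective S
    exact ⟨⟨ConjAct.toConjAct g, ⟨⟨A, hS⟩,
      Subtype.ext ((conjAct_smul_eq_iff (ConjAct.toConjAct g) A).2 hTS)⟩⟩, rfl⟩

end MatrixCount

/-! ### Parabolic subgroups as stabilizers of standard flags -/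

/-- The number of orbits of the parabolic subgroup `P^l(K)` on `M^l(K) ∩ 𝒴_F`. -/
noncomputable def blockClassCount {K : Type*} [Field K] (F : Set (AlgebraicClosure K))
    (l : List ℕ) : ℕ :=
  orbitCount (parabolicConj K l) (blockPart l (classMatrices F (BlockIndex l)))

/-- The vectors whose coordinates outside the first `a + 1` blocks vanish. -/
def stdSubmodule (K : Type*) [Field K] (l : List ℕ) (a : ℕ) : Submodule K (BlockIndex l → K) where
  carrier := {v | ∀ x : BlockIndex l, a < x.1 → v x = 0}
  add_mem' hv hw x hx := by rw [Pi.add_apply, hv x hx, hw x hx, add_zero]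
  zero_mem' _ _ := rfl
  smul_mem' c v hv x hx := by rw [Pi.smul_apply, hv x hx, smul_zero]

/-- The standard flag, from the largest proper submodule down. -/
def stdFlag (K : Type*) [Field K] (l : List ℕ) : List (Submodule K (BlockIndex l → K)) :=
  ((List.range (l.length - 1)).map (stdSubmodule K l)).reverse

section Block
variable {K : Type*} [Field K] {l : List ℕ}

theorem mem_stdFlag {W : Submodule K (BlockIndex l → K)} :
    W ∈ stdFlag K l ↔ ∃ a < l.length - 1, stdSubmodule K l a = W := by
  simp [stdFlag]

theorem stdFlag_pairwise (K : Type*) [Field K] (l : List ℕ) :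
    (stdFlag K l).Pairwise (· ≥ ·) := by
  rw [stdFlag, List.pairwise_reverse, List.pairwise_map]
  exact List.pairwise_lt_range.imp fun {a b} hab v hv x hx => hv x (by omega)

theorem blockTriangular_iff (A : Matrix (BlockIndex l) (BlockIndex l) K) :
    A.BlockTriangular Sigma.fst ↔ ∀ W ∈ stdFlag K l, ∀ v ∈ W, Matrix.toLin' A v ∈ W := by
  constructor
  · intro hA W hW v hv
    obtain ⟨a, -, rfl⟩ := mem_stdFlag.1 hW
    intro i hi
    rw [Matrix.toLin'_apply, Matrix.mulVec, dotProduct]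
    refine Finset.sum_eq_zero fun j _ => ?_
    by_cases hj : a < j.1
    · rw [hv j hj, mul_zero]
    · rw [hA (show j.1 < i.1 from Fin.lt_def.2 (by omega)), zero_mul]
  · intro H i j hij
    have hij' : j.1.1 < i.1.1 := hij
    -- Column `j` is tested on its basis vector, which lies in the step of the flag with index
    -- `j.1`; that step is in the list because `j.1 < i.1`.
    have h := H _ (mem_stdFlag.2 ⟨j.1, by have := i.1.2; omega, rfl⟩) (Pi.single j 1)
      (fun x hx => by
        rw [Pi.single_apply, if_neg]
        rintro rfl
        exact lt_irrefl _ hx) i hij'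
    rwa [Matrix.toLin'_apply, Matrix.mulVec_single_one] at h

theorem card_parabolicConj : Nat.card (parabolicConj K l) = Nat.card (flagStab (stdFlag K l)) := by
  refine Nat.card_eq_of_bijective
    (fun g => (⟨Matrix.toLin' (ConjAct.ofConjAct g.1).val, isUnit_toLin' _,
      (blockTriangular_iff _).1 g.2⟩ : flagStab (stdFlag K l))) ⟨?_, ?_⟩
  · intro g g' h
    exact Subtype.ext (Units.ext (Matrix.toLin'.injective (congrArg Subtype.val h)))
  · rintro ⟨T, hT, hT'⟩
    obtain ⟨g, rfl⟩ := exists_toLin'_eq hT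
    exact ⟨⟨ConjAct.toConjAct g, (blockTriangular_iff _).2 hT'⟩, rfl⟩

theorem blockClassCount_mul_card (F : Set (AlgebraicClosure K)) (l : List ℕ) :
    blockClassCount F l * Nat.card (flagStab (stdFlag K l)) =
      Nat.card (flagPairs F (stdFlag K l)) := by
  rw [blockClassCount, ← card_parabolicConj, orbitCount_mul_card]
  refine Nat.card_eq_of_bijective
    (fun q => (⟨(Matrix.toLin' (ConjAct.ofConjAct q.1.1).val, Matrix.toLin' q.2.1.1),
      ⟨isUnit_toLin' _, q.2.1.2.2,
        (conjAct_smul_eq_iff _ _).1 (congrArg Subtype.val q.2.2)⟩,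
      fun W hW => ⟨(blockTriangular_iff _).1 q.1.2 W hW, (blockTriangular_iff _).1 q.2.1.2.1 W hW⟩⟩ :
      flagPairs F (stdFlag K l))) ⟨?_, ?_⟩
  · rintro ⟨⟨g, hg0⟩, ⟨A, hA⟩, hg⟩ ⟨⟨g', hg0'⟩, ⟨A', hA'⟩, hg'⟩ h
    have h' := Prod.ext_iff.1 (congrArg Subtype.val h)
    obtain rfl : g = g' := Units.ext (Matrix.toLin'.injective h'.1)
    obtain rfl : A = A' := Matrix.toLin'.injective h'.2
    rfl
  · rintro ⟨⟨T, S⟩, ⟨hT, hS, hTS⟩, hflag⟩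
    obtain ⟨g, rfl⟩ := exists_toLin'_eq hT
    obtain ⟨A, rfl⟩ := Matrix.toLin'.surjective S
    exact ⟨⟨⟨ConjAct.toConjAct g, (blockTriangular_iff _).2 fun W hW => (hflag W hW).1⟩,
      ⟨⟨A, (blockTriangular_iff _).2 fun W hW => (hflag W hW).2, hS⟩,
      Subtype.ext ((conjAct_smul_eq_iff (ConjAct.toConjAct g) A).2 hTS)⟩⟩, rfl⟩

theorem finrank_vanishing {ι : Type*} [Fintype ι] (p : ι → Prop) [DecidablePred p]
    (W : Submodule K (ι → K)) (hW : ∀ v, v ∈ W ↔ ∀ x, ¬ p x → v x = 0) :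
    Module.finrank K W = Fintype.card {x // p x} := by
  rw [← Module.finrank_fintype_fun_eq_card K]
  refine LinearEquiv.finrank_eq (LinearEquiv.ofBijective
    ((LinearMap.funLeft K K (Subtype.val : {x // p x} → ι)) ∘ₗ W.subtype) ⟨?_, ?_⟩)
  · rw [injective_iff_map_eq_zero]
    rintro ⟨v, hv⟩ h
    ext x
    by_cases hx : p x
    · exact congrFun h ⟨x, hx⟩
    · exact (hW v).1 hv x hx
  · intro w
    refine ⟨⟨fun x => if h : p x then w ⟨x, h⟩ else 0, (hW _).2 fun x hx => dif_neg hx⟩, ?_⟩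
    ext x
    exact dif_pos x.2

theorem sum_fin_ite_le (l : List ℕ) (a : ℕ) :
    ∑ x : Fin l.length, (if x.1 ≤ a then l.get x else 0) = (l.take (a + 1)).sum := by
  induction l generalizing a with
  | nil => simp
  | cons d l ih =>
    rw [List.take_succ_cons, List.sum_cons]
    refine (Fin.sum_univ_succ _).trans ?_
    cases a with
    | zero => simp
    | succ a =>
      rw [← ih a]
      simp

theorem finrank_stdSubmodule (a : ℕ) :
    Module.finrank K (stdSubmodule K l a) = (l.take (a + 1)).sum := by
  rw [finrank_vanishing (fun x : BlockIndex l => x.1.1 ≤ a) _ fun v => by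
    simp only [not_le]; rfl]
  rw [Fintype.card_subtype, Finset.card_filter, Fintype.sum_sigma]
  rw [← sum_fin_ite_le]
  refine Finset.sum_congr rfl fun x _ => ?_
  split_ifs <;> simp

/-- The space `V` is arbitrary of the right dimension, so that all partitions `λ` can be counted on
the same `K ^ m`. -/
theorem blockClassCount_mul_glCard [Finite K] (F : Set (AlgebraicClosure K)) (l : List ℕ)
    {V : Type*} [AddCommGroup V] [Module K V] [Module.Finite K V]
    (hd : Module.finrank K V = l.sum) :
    blockClassCount F l * glCard K V = Nat.card (Σ p : commPairs F V, flagsIn p.1 ⊤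
      ((stdFlag K l).map fun W : Submodule K (BlockIndex l → K) => Module.finrank K W)) := by
  have hd' : Module.finrank K (BlockIndex l → K) = Module.finrank K V := by
    rw [hd, Module.finrank_fintype_fun_eq_card, Fintype.card_sigma]
    simp [← List.sum_ofFn]
  have hpos : 0 < Nat.card (flagStab (stdFlag K l)) := by
    have : Nonempty (flagStab (stdFlag K l)) := ⟨⟨1, isUnit_one, fun _ _ _ h => h⟩⟩
    exact Nat.card_pos
  refine Nat.eq_of_mul_eq_mul_left hpos ?_
  rw [← card_flagPairs_mul hd' (stdFlag_pairwise K l), ← blockClassCount_mul_card]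
  ring

end Block

/-! ### The case of two blocks -/

section TwoBlocks
variable {K : Type*} [Field K] {F : Set (AlgebraicClosure K)}
  {L U : Type*} [AddCommGroup L] [Module K L] [AddCommGroup U] [Module K U]

/-- The endomorphism of `U` induced by an endomorphism of `L × U`. -/
def quotientBlock (T : Module.End K (L × U)) : Module.End K U :=
  LinearMap.snd K L U ∘ₗ T ∘ₗ LinearMap.inr K L U

theorem quotientBlock_eq {T : Module.End K (L × U)} {h : Module.End K U}
    (hT : LinearMap.snd K L U ∘ₗ T = h ∘ₗ LinearMap.snd K L U) : quotientBlock T = h := by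
  rw [quotientBlock, ← LinearMap.comp_assoc, hT, LinearMap.comp_assoc, LinearMap.snd_comp_inr,
    LinearMap.comp_id]

theorem snd_comp_iff (T : Module.End K (L × U)) :
    LinearMap.snd K L U ∘ₗ T = quotientBlock T ∘ₗ LinearMap.snd K L U ↔
      ∀ x ∈ LinearMap.ker (LinearMap.snd K L U), T x ∈ LinearMap.ker (LinearMap.snd K L U) := by
  constructor
  · intro H x hx
    rw [LinearMap.mem_ker] at *
    have := LinearMap.congr_fun H x
    rwa [LinearMap.comp_apply, LinearMap.comp_apply, hx, map_zero] at this
  · intro H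
    ext x
    · have h0 : T (0, 0) = 0 := map_zero T
      simpa [quotientBlock, h0] using H (x, 0) (by simp)
    · simp [quotientBlock]

theorem map_mem_ker_snd {T : Module.End K (L × U)} {h : Module.End K U}
    (hT : LinearMap.snd K L U ∘ₗ T = h ∘ₗ LinearMap.snd K L U) :
    ∀ x ∈ LinearMap.ker (LinearMap.snd K L U), T x ∈ LinearMap.ker (LinearMap.snd K L U) := by
  obtain rfl := quotientBlock_eq hT
  exact (snd_comp_iff T).1 hT

theorem quotientBlock_mul {T S : Module.End K (L × U)}
    (hT : LinearMap.snd K L U ∘ₗ T = quotientBlock T ∘ₗ LinearMap.snd K L U)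
    (hS : LinearMap.snd K L U ∘ₗ S = quotientBlock S ∘ₗ LinearMap.snd K L U) :
    quotientBlock (T * S) = quotientBlock T * quotientBlock S := by
  apply quotientBlock_eq
  rw [Module.End.mul_eq_comp, ← LinearMap.comp_assoc, hT, LinearMap.comp_assoc, hS,
    ← LinearMap.comp_assoc]
  rfl

theorem homInto_top {V : Type*} [AddCommGroup V] [Module K V]
    (p : Module.End K V × Module.End K V) :
    homInto F L p ⊤ = homCount F L p.1 p.2 :=
  Nat.card_congr ⟨fun q => q.1, fun q => ⟨q, le_top⟩, fun _ => rfl, fun _ => rfl⟩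

variable [Module.Finite K L] [Module.Finite K U]

theorem isUnit_quotientBlock {T : Module.End K (L × U)} (h : IsUnit T)
    (hT : LinearMap.snd K L U ∘ₗ T = quotientBlock T ∘ₗ LinearMap.snd K L U) :
    IsUnit (quotientBlock T) := by
  rw [eq_blockEnd hT] at h
  exact (isUnit_blockEnd_iff.1 h).2

theorem isClassEnd_quotientBlock {T : Module.End K (L × U)} (h : IsClassEnd F T)
    (hT : LinearMap.snd K L U ∘ₗ T = quotientBlock T ∘ₗ LinearMap.snd K L U) :
    IsClassEnd F (quotientBlock T) := by
  rw [eq_blockEnd hT] at h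
  exact (isClassEnd_blockEnd_iff.1 h).2

theorem finrank_ker_snd :
    Module.finrank K (LinearMap.ker (LinearMap.snd K L U)) = Module.finrank K L := by
  have h := LinearMap.finrank_range_add_finrank_ker (LinearMap.snd K L U)
  rw [LinearMap.range_eq_top.2 LinearMap.snd_surjective, finrank_top, Module.finrank_prod] at h
  omega

variable [Finite K]

theorem card_flagStab_ker_snd :
    Nat.card (flagStab [LinearMap.ker (LinearMap.snd K L U)]) =
      glCard K U * (glCard K L * Nat.card (U →ₗ[K] L)) := by
  have H : ∀ g : flagStab [LinearMap.ker (LinearMap.snd K L U)],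
      LinearMap.snd K L U ∘ₗ g.1 = quotientBlock g.1 ∘ₗ LinearMap.snd K L U := fun g =>
    (snd_comp_iff _).2 (g.2.2 _ List.mem_cons_self)
  let E : flagStab [LinearMap.ker (LinearMap.snd K L U)] ≃
      Σ h : {h : Module.End K U // IsUnit h}, {g : {g : Module.End K (L × U) // IsUnit g} //
        LinearMap.snd K L U ∘ₗ g.1 = h.1 ∘ₗ LinearMap.snd K L U} :=
    { toFun := fun g => ⟨⟨quotientBlock g.1, isUnit_quotientBlock g.2.1 (H g)⟩,
        ⟨⟨g.1, g.2.1⟩, H g⟩⟩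
      invFun := fun q => ⟨q.2.1.1, q.2.1.2, by
        rw [List.forall_mem_singleton]
        exact map_mem_ker_snd q.2.2⟩
      left_inv := fun _ => rfl
      right_inv := by
        rintro ⟨⟨h, hh⟩, ⟨g, hg⟩⟩
        obtain rfl : quotientBlock g.1 = h := quotientBlock_eq hg
        rfl }
  rw [Nat.card_congr E]
  exact card_sigma_of_const fun h => card_unitLift h.2

theorem card_flagPairs_ker_snd [Fintype (commPairs F U)] :
    Nat.card (flagPairs F [LinearMap.ker (LinearMap.snd K L U)]) =
      Nat.card (U →ₗ[K] L) * ∑ p : commPairs F U, homCount F L p.1.1 p.1.2 := by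
  have H : ∀ g : flagPairs F [LinearMap.ker (LinearMap.snd K L U)],
      LinearMap.snd K L U ∘ₗ g.1.1 = quotientBlock g.1.1 ∘ₗ LinearMap.snd K L U ∧
      LinearMap.snd K L U ∘ₗ g.1.2 = quotientBlock g.1.2 ∘ₗ LinearMap.snd K L U := fun g =>
    ⟨(snd_comp_iff _).2 (g.2.2 _ List.mem_cons_self).1,
      (snd_comp_iff _).2 (g.2.2 _ List.mem_cons_self).2⟩
  let E : flagPairs F [LinearMap.ker (LinearMap.snd K L U)] ≃
      Σ p : commPairs F U, {q : commPairs F (L × U) //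
        LinearMap.snd K L U ∘ₗ q.1.1 = p.1.1 ∘ₗ LinearMap.snd K L U ∧
        LinearMap.snd K L U ∘ₗ q.1.2 = p.1.2 ∘ₗ LinearMap.snd K L U} :=
    { toFun := fun g => ⟨⟨(quotientBlock g.1.1, quotientBlock g.1.2),
        isUnit_quotientBlock g.2.1.1 (H g).1, isClassEnd_quotientBlock g.2.1.2.1 (H g).2, by
          rw [← quotientBlock_mul (H g).1 (H g).2, ← quotientBlock_mul (H g).2 (H g).1,
            g.2.1.2.2]⟩,
        ⟨⟨g.1, g.2.1⟩, H g⟩⟩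
      invFun := fun q => ⟨q.2.1.1, q.2.1.2, by
        rw [List.forall_mem_singleton]
        exact ⟨map_mem_ker_snd q.2.2.1, map_mem_ker_snd q.2.2.2⟩⟩
      left_inv := fun _ => rfl
      right_inv := by
        rintro ⟨⟨⟨h, B⟩, hh⟩, ⟨⟨⟨g, A⟩, hp⟩, hg, hA⟩⟩
        obtain rfl : quotientBlock g = h := quotientBlock_eq hg
        obtain rfl : quotientBlock A = B := quotientBlock_eq hA
        rfl }
  rw [Nat.card_congr E, Nat.card_sigma, Finset.mul_sum]
  exact Finset.sum_congr rfl fun p _ => card_lift p.2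

/-- The general flag formula on `L × U` is compared with the direct count for the single subspace
`ker snd`; the factors `|GL(L × U)|` and `|Hom(U, L)|` cancel. -/
theorem blockClassCount_pair_mul [Fintype (commPairs F U)] :
    blockClassCount F [Module.finrank K L, Module.finrank K U] * glCard K U * glCard K L =
      ∑ p : commPairs F U, homInto F L p.1 ⊤ := by
  have h1 := blockClassCount_mul_glCard F [Module.finrank K L, Module.finrank K U] (V := L × U)
    (by simp [Module.finrank_prod])
  have h2 := card_flagPairs_mul (F := F) (V := L × U) (V' := L × U) rfl
    (c := [LinearMap.ker (LinearMap.snd K L U)]) (List.pairwise_singleton _ _)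
  have h3 : (stdFlag K [Module.finrank K L, Module.finrank K U]).map
      (fun W : Submodule K (BlockIndex [Module.finrank K L, Module.finrank K U] → K) =>
        Module.finrank K W) = [LinearMap.ker (LinearMap.snd K L U)].map
      (fun W : Submodule K (L × U) => Module.finrank K W) := by
    simp [stdFlag, finrank_ker_snd, finrank_stdSubmodule]
  rw [h3] at h1
  rw [← h1, card_flagStab_ker_snd, card_flagPairs_ker_snd] at h2
  have hG : 0 < glCard K (L × U) := glCard_pos
  have hH : 0 < Nat.card (U →ₗ[K] L) := Nat.card_pos
  have h4 : Nat.card (U →ₗ[K] L) * (∑ p : commPairs F U, homCount F L p.1.1 p.1.2) =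
      Nat.card (U →ₗ[K] L) * (blockClassCount F [Module.finrank K L, Module.finrank K U] *
        glCard K U * glCard K L) := by
    refine Nat.eq_of_mul_eq_mul_right hG (h2.trans ?_)
    ring
  simp only [homInto_top]
  exact (Nat.eq_of_mul_eq_mul_left hH h4).symm

end TwoBlocks

/-! ### The block sizes attached to a partition -/

section Delta

theorem length_delta (m : ℕ) {j : ℕ} (lam : Nat.Partition j) :
    (delta m lam).length = (lam.parts.sort (· ≤ ·)).length + 1 := by
  simp [delta]

/-- The differences telescope. The preceding entry `p` is carried along for the induction, and
monotonicity keeps the truncated subtraction exact. -/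
theorem sum_take_zipWith_sub (s : List ℕ) (p m a : ℕ) (hs : (p :: s).Pairwise (· ≤ ·))
    (ha : a < s.length) :
    ((List.zipWith (fun a b => a - b) (s ++ [m]) (p :: s)).take (a + 1)).sum + p = s[a] := by
  induction s generalizing p a with
  | nil => simp at ha
  | cons d s ih =>
    obtain ⟨h1, h2⟩ := List.pairwise_cons.1 hs
    have hpd := h1 d List.mem_cons_self
    rw [List.cons_append, List.zipWith_cons_cons, List.take_succ_cons, List.sum_cons]
    cases a with
    | zero => simp; omega
    | succ a =>
      have := ih d a h2 (by simpa using ha)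
      rw [List.getElem_cons_succ, ← this]
      omega

theorem sum_zipWith_sub (s : List ℕ) (p m : ℕ) (hs : (p :: s).Pairwise (· ≤ ·)) (hp : p ≤ m)
    (hm : ∀ x ∈ s, x ≤ m) :
    (List.zipWith (fun a b => a - b) (s ++ [m]) (p :: s)).sum + p = m := by
  induction s generalizing p with
  | nil => simp; omega
  | cons d s ih =>
    obtain ⟨h1, h2⟩ := List.pairwise_cons.1 hs
    have hpd := h1 d List.mem_cons_self
    rw [List.cons_append, List.zipWith_cons_cons, List.sum_cons]
    have := ih d h2 (hm d List.mem_cons_self) fun x hx => hm x (List.mem_cons_of_mem _ hx)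
    omega

theorem pairwise_zero_cons_sort (s : Multiset ℕ) : (0 :: s.sort (· ≤ ·)).Pairwise (· ≤ ·) :=
  List.pairwise_cons.2 ⟨fun _ _ => Nat.zero_le _, s.pairwise_sort (· ≤ ·)⟩

theorem sum_delta {m j : ℕ} {lam : Nat.Partition j} (h : ∀ i ∈ lam.parts, i ≤ m) :
    (delta m lam).sum = m :=
  sum_zipWith_sub _ 0 m (pairwise_zero_cons_sort _) (Nat.zero_le _)
    fun x hx => h x ((Multiset.mem_sort _).1 hx)

theorem finrank_stdFlag_delta (K : Type*) [Field K] (m : ℕ) {j : ℕ} (lam : Nat.Partition j) :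
    (stdFlag K (delta m lam)).map
      (fun W : Submodule K (BlockIndex (delta m lam) → K) => Module.finrank K W) =
      (lam.parts.sort (· ≤ ·)).reverse := by
  rw [stdFlag, List.map_reverse, List.map_map, length_delta, Nat.add_sub_cancel]
  congr 1
  refine List.ext_getElem (by simp) fun a h1 h2 => ?_
  rw [List.getElem_map, List.getElem_range, Function.comp, finrank_stdSubmodule]
  exact sum_take_zipWith_sub _ 0 m a (pairwise_zero_cons_sort _) h2

theorem delta_indiscrete {k : ℕ} (hk : 0 < k) (m : ℕ) :
    delta (k + m) (Nat.Partition.indiscrete k) = [k, m] := by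
  simp [delta, Nat.Partition.indiscrete_parts hk.ne']

end Delta

/-! ### From lists to partitions, and the formula for arbitrary classes -/

/-- Partitions correspond to weakly decreasing positive lists; `hf` discards all other lists. -/
theorem sum_boundedPartitions {R : Type*} [AddCommMonoid R] (k m : ℕ) (f : List ℕ → R)
    (hf : ∀ s, f s ≠ 0 → s.Pairwise (· ≥ ·) ∧ ∀ x ∈ s, x ≤ m) :
    ∑ j ∈ Finset.range (k + 1), ∑ lam ∈ boundedPartitions j m,
      f (lam.parts.sort (· ≤ ·)).reverse = ∑ s ∈ posLists k, f s := by
  classical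
  have h1 : ∑ s ∈ posLists k, f s =
      ∑ s ∈ (posLists k).filter (fun s => s.Pairwise (· ≥ ·) ∧ ∀ x ∈ s, x ≤ m), f s :=
    (Finset.sum_filter_of_ne fun s _ h => hf s h).symm
  rw [h1, Finset.sum_sigma']
  refine Finset.sum_bij (fun q _ => (q.2.parts.sort (· ≤ ·)).reverse) ?_ ?_ ?_ fun _ _ => rfl
  · rintro ⟨j, lam⟩ h
    obtain ⟨hj, hl⟩ := Finset.mem_sigma.1 h
    rw [Finset.mem_filter, mem_posLists]
    have hsum : (lam.parts.sort (· ≤ ·)).sum = j := by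
      rw [← Multiset.sum_coe, Multiset.sort_eq, lam.parts_sum]
    refine ⟨⟨fun x hx => lam.parts_pos (by simpa using hx), ?_⟩, ?_, fun x hx => ?_⟩
    · rw [List.sum_reverse, hsum]
      exact Nat.lt_succ_iff.1 (Finset.mem_range.1 hj)
    · rw [List.pairwise_reverse]
      exact lam.parts.pairwise_sort (· ≤ ·)
    · exact (Finset.mem_filter.1 hl).2 x (by simpa using hx)
  · rintro ⟨j, lam⟩ - ⟨j', lam'⟩ - h
    have h2 : lam.parts = lam'.parts := by
      rw [← Multiset.sort_eq lam.parts (· ≤ ·), ← Multiset.sort_eq lam'.parts (· ≤ ·)]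
      exact congrArg _ (List.reverse_injective h)
    obtain rfl : j = j' := by rw [← lam.parts_sum, ← lam'.parts_sum, h2]
    obtain rfl : lam = lam' := Nat.Partition.ext h2
    rfl
  · intro s hs
    rw [Finset.mem_filter, mem_posLists] at hs
    obtain ⟨⟨h2, h3⟩, h4, h5⟩ := hs
    refine ⟨⟨s.sum, ⟨(s : Multiset ℕ), fun hx => h2 _ (by simpa using hx), by simp⟩⟩, ?_, ?_⟩
    · rw [Finset.mem_sigma, Finset.mem_range, boundedPartitions, Finset.mem_filter]
      exact ⟨Nat.lt_succ_iff.2 h3, Finset.mem_univ _, fun x hx => h5 x (by simpa using hx)⟩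
    · rw [List.reverse_eq_iff]
      refine List.Perm.eq_of_pairwise (le := (· ≤ ·)) (fun a b _ _ => le_antisymm)
        (Multiset.pairwise_sort _ _) (List.pairwise_reverse.2 h4) ?_
      rw [← Multiset.coe_eq_coe, Multiset.sort_eq]
      exact (Multiset.coe_reverse s).symm

theorem blockClassCount_pair {K : Type*} [Field K] [Finite K] (F : Set (AlgebraicClosure K))
    (k m : ℕ) :
    blockClassCount F [k, m] = ∑ j ∈ Finset.range (k + 1),
      classCount F (k - j) * ∑ lam ∈ boundedPartitions j m, kappa F m lam := by
  have := Fintype.ofFinite (commPairs F (Fin m → K))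
  have hG : ∀ n, (glCard K (Fin n → K) : ℚ) ≠ 0 := fun n => by exact_mod_cast glCard_pos.ne'
  have hc : ∀ n, (Nat.card (commPairs F (Fin n → K)) : ℚ) / glCard K (Fin n → K) =
      classCount F n := fun n => by
    rw [div_eq_iff (hG n)]
    exact_mod_cast (classCount_mul_glCard F n).symm
  let N : List ℕ → ℚ := fun s => Nat.card (Σ p : commPairs F (Fin m → K), flagsIn p.1 ⊤ s)
  have hfin : ∀ (p : commPairs F (Fin m → K)) s, Finite (flagsIn p.1 ⊤ s) :=
    fun p s => finite_flagsIn _ _ _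
  -- A nonzero count means that a flag exists, and the dimensions along it decrease weakly and are
  -- at most `m`.
  have hN : ∀ s, N s ≠ 0 → s.Pairwise (· ≥ ·) ∧ ∀ x ∈ s, x ≤ m := by
    intro s hs
    have hne : Nonempty (Σ p : commPairs F (Fin m → K), flagsIn p.1 ⊤ s) := by
      by_contra h
      rw [not_nonempty_iff] at h
      exact hs (by simp [N])
    obtain ⟨⟨p, c, h1, h2, -⟩⟩ := hne
    subst h1
    rw [List.pairwise_map]
    refine ⟨h2.imp fun h => Submodule.finrank_mono h, fun x hx => ?_⟩
    obtain ⟨W, -, rfl⟩ := List.mem_map.1 hx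
    exact (Submodule.finrank_le W).trans_eq (Module.finrank_fin_fun K)
  have hL : (blockClassCount F [k, m] : ℚ) * glCard K (Fin m → K) =
      ∑ s ∈ posLists k, (classCount F (k - s.sum) : ℚ) * N s := by
    have h1 := blockClassCount_pair_mul (F := F) (L := Fin k → K) (U := Fin m → K)
    rw [Module.finrank_fin_fun, Module.finrank_fin_fun] at h1
    have h2 : (blockClassCount F [k, m] : ℚ) * glCard K (Fin m → K) =
        ∑ p : commPairs F (Fin m → K),
          (homInto F (Fin k → K) p.1 ⊤ : ℚ) / glCard K (Fin k → K) := by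
      rw [← Finset.sum_div, eq_div_iff (hG k)]
      exact_mod_cast h1
    rw [h2]
    simp only [homInto_div_eq_sum (Subtype.coe_prop _), hc, N]
    rw [Finset.sum_comm]
    refine Finset.sum_congr rfl fun s _ => ?_
    rw [Nat.card_sigma, Nat.cast_sum, Finset.mul_sum]
  have hR : ∀ j, ∀ lam ∈ boundedPartitions j m, (kappa F m lam : ℚ) * glCard K (Fin m → K) =
      N (lam.parts.sort (· ≤ ·)).reverse := by
    intro j lam hl
    have h1 := blockClassCount_mul_glCard F (delta m lam) (V := Fin m → K)
      (by rw [Module.finrank_fin_fun, sum_delta (Finset.mem_filter.1 hl).2])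
    rw [finrank_stdFlag_delta] at h1
    exact (Nat.cast_mul _ _).symm.trans (congrArg Nat.cast h1)
  have key : (blockClassCount F [k, m] : ℚ) = ∑ j ∈ Finset.range (k + 1),
      classCount F (k - j) * ∑ lam ∈ boundedPartitions j m, kappa F m lam := by
    apply mul_right_cancel₀ (hG m)
    rw [hL, ← sum_boundedPartitions k m (fun s => (classCount F (k - s.sum) : ℚ) * N s)
      fun s hs => hN s (right_ne_zero_of_mul hs),
      Nat.cast_sum, Finset.sum_mul]
    refine Finset.sum_congr rfl fun j _ => ?_
    push_cast
    rw [mul_assoc, Finset.sum_mul, Finset.mul_sum]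
    refine Finset.sum_congr rfl fun lam hl => ?_
    rw [hR j lam hl, List.sum_reverse, ← Multiset.sum_coe, Multiset.sort_eq, lam.parts_sum]
  exact_mod_cast key

/-! ### Nilpotent endomorphisms and Jordan form -/

/-- Similarity of endomorphisms of possibly different vector spaces. -/
def EndSimilar {K V V' : Type*} [Field K] [AddCommGroup V] [Module K V] [AddCommGroup V']
    [Module K V'] (T : Module.End K V) (S : Module.End K V') : Prop :=
  ∃ e : V ≃ₗ[K] V', ∀ v, e (T v) = S (e v)

namespace EndSimilar
variable {K V V' V'' : Type*} [Field K] [AddCommGroup V] [Module K V] [AddCommGroup V']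
  [Module K V'] [AddCommGroup V''] [Module K V''] {T : Module.End K V} {S : Module.End K V'}
  {R : Module.End K V''}

theorem symm (h : EndSimilar T S) : EndSimilar S T := by
  obtain ⟨e, he⟩ := h
  exact ⟨e.symm, fun v => by rw [LinearEquiv.symm_apply_eq, he, LinearEquiv.apply_symm_apply]⟩

theorem trans (h : EndSimilar T S) (h' : EndSimilar S R) : EndSimilar T R := by
  obtain ⟨e, he⟩ := h
  obtain ⟨f, hf⟩ := h'
  exact ⟨e.trans f, fun v => by rw [LinearEquiv.trans_apply, he, hf, LinearEquiv.trans_apply]⟩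

theorem conj (e : V ≃ₗ[K] V') (T : Module.End K V) : EndSimilar T (e.conj T) :=
  ⟨e, fun v => by simp [LinearEquiv.conj_apply]⟩

theorem finrank_ker_pow_eq (h : EndSimilar T S) (t : ℕ) :
    Module.finrank K (LinearMap.ker (T ^ t)) = Module.finrank K (LinearMap.ker (S ^ t)) := by
  obtain ⟨e, he⟩ := h
  have hpow : ∀ v, e ((T ^ t) v) = (S ^ t) (e v) := by
    induction t with
    | zero => intro v; rfl
    | succ t ih => intro v; rw [pow_succ, pow_succ, Module.End.mul_apply, ih, he]; rfl
  have : LinearMap.ker (T ^ t) = (LinearMap.ker (S ^ t)).comap e.toLinearMap := by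
    ext v
    rw [Submodule.mem_comap, LinearMap.mem_ker, LinearMap.mem_ker, LinearEquiv.coe_coe, ← hpow,
      LinearEquiv.map_eq_zero_iff]
  rw [this]
  exact (e.ofSubmodule' _).finrank_eq

end EndSimilar

section Jordan
variable (K : Type*) [Field K] {ι ι' : Type*}

/-- The nilpotent endomorphism with Jordan blocks of sizes `k i`. -/
def nilpotentShift (k : ι → ℕ) : Module.End K ((Σ i, Fin (k i)) → K) where
  toFun f x := if h : x.2.1 + 1 < k x.1 then f ⟨x.1, ⟨x.2.1 + 1, h⟩⟩ else 0
  map_add' f g := by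
    ext x
    simp only [Pi.add_apply]
    split_ifs <;> simp
  map_smul' c f := by
    ext x
    simp only [Pi.smul_apply, RingHom.id_apply]
    split_ifs <;> simp

variable {K}

theorem nilpotentShift_apply (k : ι → ℕ) (f : (Σ i, Fin (k i)) → K) (x : Σ i, Fin (k i)) :
    nilpotentShift K k f x = if h : x.2.1 + 1 < k x.1 then f ⟨x.1, ⟨x.2.1 + 1, h⟩⟩ else 0 := rfl

theorem nilpotentShift_pow_apply (k : ι → ℕ) (t : ℕ) (f : (Σ i, Fin (k i)) → K)
    (x : Σ i, Fin (k i)) : (nilpotentShift K k ^ t) f x =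
      if h : x.2.1 + t < k x.1 then f ⟨x.1, ⟨x.2.1 + t, h⟩⟩ else 0 := by
  induction t generalizing f with
  | zero =>
    rw [dif_pos (show x.2.1 + 0 < k x.1 from x.2.2)]
    rfl
  | succ t ih =>
    rw [pow_succ, Module.End.mul_apply, ih]
    by_cases h : x.2.1 + (t + 1) < k x.1
    · rw [dif_pos h, dif_pos (show x.2.1 + t < k x.1 by omega), nilpotentShift_apply]
      exact dif_pos h
    · rw [dif_neg h]
      split_ifs with h'
      · rw [nilpotentShift_apply]
        exact dif_neg h
      · rfl

theorem isNilpotent_nilpotentShift [Fintype ι] (k : ι → ℕ) : IsNilpotent (nilpotentShift K k) := by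
  refine ⟨∑ i, k i, LinearMap.ext fun f => funext fun x => ?_⟩
  have := Finset.single_le_sum (f := k) (fun _ _ => Nat.zero_le _) (Finset.mem_univ x.1)
  rw [nilpotentShift_pow_apply, dif_neg (by omega)]
  rfl

/-- The kernel of the `t`-th power consists of the functions supported on positions below `t`, of
which block `i` has `min (k i) t`. -/
theorem finrank_ker_nilpotentShift_pow [Fintype ι] (k : ι → ℕ) (t : ℕ) :
    Module.finrank K (LinearMap.ker (nilpotentShift K k ^ t)) = ∑ i, min (k i) t := by
  rw [finrank_vanishing (fun x : Σ i, Fin (k i) => x.2.1 < t)]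
  · rw [Fintype.card_subtype, Finset.card_filter, Fintype.sum_sigma]
    refine Finset.sum_congr rfl fun i _ => ?_
    rw [← Finset.card_filter, Fin.card_filter_val_lt]
  · intro f
    rw [LinearMap.mem_ker]
    constructor
    · rintro h ⟨i, a⟩ ha
      have ha' : t ≤ a.1 := not_lt.1 ha
      have := congrFun h ⟨i, ⟨a.1 - t, by omega⟩⟩
      rw [nilpotentShift_pow_apply, dif_pos (by simp only; omega)] at this
      simp only [Nat.sub_add_cancel ha'] at this
      exact this
    · intro h
      ext x
      rw [nilpotentShift_pow_apply]
      split_ifs with h'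
      · exact h _ (by simp)
      · rfl

theorem sum_min_succ [Fintype ι] (k : ι → ℕ) (t : ℕ) :
    ∑ i, min (k i) (t + 1) = ∑ i, min (k i) t + (Finset.univ.filter fun i => t < k i).card := by
  rw [Finset.card_filter, ← Finset.sum_add_distrib]
  refine Finset.sum_congr rfl fun i _ => ?_
  split_ifs <;> omega

theorem card_filter_lt_eq [Fintype ι] (k : ι → ℕ) (t : ℕ) :
    (Finset.univ.filter fun i => t < k i).card = (Finset.univ.filter fun i => t + 1 < k i).card +
      (Finset.univ.filter fun i => k i = t + 1).card := by
  rw [Finset.card_filter, Finset.card_filter, Finset.card_filter, ← Finset.sum_add_distrib]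
  refine Finset.sum_congr rfl fun i _ => ?_
  split_ifs <;> omega

/-- The first differences of these sums count blocks larger than `t`, and the second differences
count blocks of an exact positive size. -/
theorem card_filter_eq_of_sum_min_eq [Fintype ι] [Fintype ι'] {k : ι → ℕ} {k' : ι' → ℕ}
    (h : ∀ t, ∑ i, min (k i) t = ∑ i, min (k' i) t) {t : ℕ} (ht : 0 < t) :
    (Finset.univ.filter fun i => k i = t).card = (Finset.univ.filter fun i => k' i = t).card := by
  obtain ⟨t, rfl⟩ := Nat.exists_eq_add_of_lt ht
  rw [Nat.zero_add]
  have h0 := h t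
  have h1 := h (t + 1)
  have h2 := h (t + 1 + 1)
  have e1 := sum_min_succ k t
  have e2 := sum_min_succ k (t + 1)
  have e3 := sum_min_succ k' t
  have e4 := sum_min_succ k' (t + 1)
  have e5 := card_filter_lt_eq k t
  have e6 := card_filter_lt_eq k' t
  omega

theorem sigma_fin_ext {k : ι → ℕ} {x y : Σ i, Fin (k i)} (h1 : x.1 = y.1) (h2 : x.2.1 = y.2.1) :
    x = y := by
  obtain ⟨i, a⟩ := x
  obtain ⟨j, b⟩ := y
  obtain rfl : i = j := h1
  obtain rfl : a = b := Fin.ext h2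
  rfl

/-- Blocks of size zero contribute no coordinates, so matching the positive blocks by size already
gives a bijection of coordinates. -/
theorem endSimilar_nilpotentShift [Fintype ι] [Fintype ι'] {k : ι → ℕ} {k' : ι' → ℕ}
    (h : ∀ t, 0 < t → (Finset.univ.filter fun i => k i = t).card =
      (Finset.univ.filter fun i => k' i = t).card) :
    EndSimilar (nilpotentShift K k) (nilpotentShift K k') := by
  have hfib : ∀ c : ℕ, Nonempty ({i : {i // 0 < k i} // k i.1 = c} ≃
      {i : {i // 0 < k' i} // k' i.1 = c}) := by
    intro c
    rcases Nat.eq_zero_or_pos c with rfl | hc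
    · have h1 : IsEmpty {i : {i // 0 < k i} // k i.1 = 0} :=
        ⟨fun i => by have := i.1.2; have := i.2; omega⟩
      have h2 : IsEmpty {i : {i // 0 < k' i} // k' i.1 = 0} :=
        ⟨fun i => by have := i.1.2; have := i.2; omega⟩
      exact ⟨Equiv.equivOfIsEmpty _ _⟩
    · have e0 : {i // k i = c} ≃ {i // k' i = c} := Fintype.equivOfCardEq (by
        rw [Fintype.card_subtype, Fintype.card_subtype, h c hc])
      exact ⟨(Equiv.subtypeSubtypeEquivSubtype fun {i} (hi : k i = c) => hi ▸ hc).trans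
        (e0.trans (Equiv.subtypeSubtypeEquivSubtype fun {i} (hi : k' i = c) => hi ▸ hc).symm)⟩
  have e := fun c => Classical.choice (hfib c)
  let τ : {i // 0 < k i} ≃ {i // 0 < k' i} := Equiv.ofFiberEquiv e
  have hτ : ∀ i, k' (τ i).1 = k i.1 := fun i => Equiv.ofFiberEquiv_map e i
  let ε : (Σ i, Fin (k i)) → Σ i, Fin (k' i) := fun x =>
    ⟨(τ ⟨x.1, x.2.pos⟩).1, ⟨x.2.1, by rw [hτ]; exact x.2.2⟩⟩
  have hε : Function.Bijective ε := by
    constructor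
    · intro x y hxy
      have h1 : (τ ⟨x.1, x.2.pos⟩).1 = (τ ⟨y.1, y.2.pos⟩).1 := congrArg Sigma.fst hxy
      refine sigma_fin_ext (congrArg Subtype.val (τ.injective (Subtype.ext h1))) ?_
      exact congrArg (fun z : Σ i, Fin (k' i) => z.2.1) hxy
    · intro y
      have h1 := hτ (τ.symm ⟨y.1, y.2.pos⟩)
      rw [Equiv.apply_symm_apply] at h1
      refine ⟨⟨(τ.symm ⟨y.1, y.2.pos⟩).1, ⟨y.2.1, by rw [← h1]; exact y.2.2⟩⟩, sigma_fin_ext ?_ rfl⟩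
      simp [ε]
  -- Pullback along `ε` goes from functions on the target to functions on the source, hence the
  -- reversal.
  refine EndSimilar.symm ⟨LinearEquiv.funCongrLeft K K (Equiv.ofBijective ε hε), fun f => ?_⟩
  ext x
  change nilpotentShift K k' f (ε x) = _
  rw [nilpotentShift_apply, nilpotentShift_apply]
  have h1 : k' (ε x).1 = k x.1 := hτ _
  have h2 : (ε x).2.1 = x.2.1 := rfl
  by_cases hx : x.2.1 + 1 < k x.1
  · rw [dif_pos hx, dif_pos (by omega)]
    rfl
  · rw [dif_neg hx, dif_neg (by omega)]

section Existence
open Polynomial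

/-- The reversed coefficients of a polynomial truncated at degree `n`. -/
noncomputable def revCoeffs (K : Type*) [Field K] (n : ℕ) : K[X] →ₗ[K] (Fin n → K) :=
  LinearMap.pi fun a => lcoeff K (n - 1 - a.1)

theorem revCoeffs_apply (n : ℕ) (p : K[X]) (a : Fin n) :
    revCoeffs K n p a = p.coeff (n - 1 - a.1) := rfl

theorem revCoeffs_surjective (n : ℕ) : Function.Surjective (revCoeffs K n) := by
  intro f
  refine ⟨∑ b : Fin n, monomial (n - 1 - b.1) (f b), funext fun a => ?_⟩
  rw [revCoeffs_apply, finsetSum_coeff, Finset.sum_eq_single a]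
  · rw [coeff_monomial, if_pos rfl]
  · intro b _ hb
    rw [coeff_monomial, if_neg]
    intro h
    apply hb
    ext
    omega
  · simp

theorem ker_revCoeffs (n : ℕ) : LinearMap.ker (revCoeffs K n) =
    (Submodule.span K[X] {(X : K[X]) ^ n}).restrictScalars K := by
  ext p
  rw [LinearMap.mem_ker, Submodule.restrictScalars_mem, Ideal.submodule_span_eq,
    Ideal.mem_span_singleton, X_pow_dvd_iff]
  constructor
  · intro h d hd
    have := congrFun h ⟨n - 1 - d, by omega⟩
    rw [revCoeffs_apply] at this
    rwa [show n - 1 - (n - 1 - d) = d by omega] at this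
  · intro h
    ext a
    exact h _ (by have := a.2; omega)

/-- The coordinates on `K[X] / (X ^ n)` in which multiplication by `X` is a shift. -/
noncomputable def quotXPowEquiv (K : Type*) [Field K] (n : ℕ) :
    (K[X] ⧸ Submodule.span K[X] {(X : K[X]) ^ n}) ≃ₗ[K] (Fin n → K) :=
  (Submodule.Quotient.restrictScalarsEquiv K (Submodule.span K[X] {(X : K[X]) ^ n})).symm.trans
    ((Submodule.quotEquivOfEq _ _ (ker_revCoeffs n).symm).trans
      ((revCoeffs K n).quotKerEquivOfSurjective (revCoeffs_surjective n)))

theorem quotXPowEquiv_mk (n : ℕ) (p : K[X]) :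
    quotXPowEquiv K n (Submodule.Quotient.mk p) = revCoeffs K n p := rfl

/-- Multiplication by `X` raises degrees; the reversed numbering turns this into the shift used in
`nilpotentShift`. -/
theorem quotXPowEquiv_X_smul (n : ℕ) (w : K[X] ⧸ Submodule.span K[X] {(X : K[X]) ^ n})
    (a : Fin n) : quotXPowEquiv K n ((X : K[X]) • w) a =
      if h : a.1 + 1 < n then quotXPowEquiv K n w ⟨a.1 + 1, h⟩ else 0 := by
  obtain ⟨p, rfl⟩ := Submodule.Quotient.mk_surjective _ w
  rw [← Submodule.Quotient.mk_smul, quotXPowEquiv_mk, quotXPowEquiv_mk, revCoeffs_apply,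
    smul_eq_mul]
  split_ifs with h
  · rw [revCoeffs_apply, show n - 1 - a.1 = n - 1 - (a.1 + 1) + 1 by omega, coeff_X_mul]
  · rw [show n - 1 - a.1 = 0 by omega, coeff_X_mul_zero]

/-- With `X` acting as `T`, the space is an `X`-power torsion module over `K[X]`; the structure
theorem splits it into quotients by powers of `X`, each a shift in suitable coordinates. -/
theorem exists_endSimilar_nilpotentShift {V : Type*} [AddCommGroup V] [Module K V]
    [Module.Finite K V] {T : Module.End K V} (hT : IsNilpotent T) :
    ∃ (d : ℕ) (k : Fin d → ℕ), EndSimilar T (nilpotentShift K k) := by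
  obtain ⟨N, hN⟩ := hT
  have htor : Module.IsTorsion' (Module.AEval' T) (Submonoid.powers (X : K[X])) := by
    intro x
    obtain ⟨v, rfl⟩ := (Module.AEval'.of T).surjective x
    refine ⟨⟨X ^ N, N, rfl⟩, ?_⟩
    change (X : K[X]) ^ N • Module.AEval'.of T v = 0
    rw [Module.AEval'.X_pow_smul_of, hN, zero_smul, map_zero]
  obtain ⟨d, k, ⟨f⟩⟩ := Module.torsion_by_prime_power_decomposition irreducible_X htor
  let g := f.trans (DirectSum.linearEquivFunOnFintype K[X] (Fin d)
    fun i => K[X] ⧸ Submodule.span K[X] {(X : K[X]) ^ k i})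
  let e : V ≃ₗ[K] ((Σ i, Fin (k i)) → K) :=
    ((Module.AEval'.of T).trans (g.restrictScalars K)).trans
      ((LinearEquiv.piCongrRight fun i => quotXPowEquiv K (k i)).trans
        (LinearEquiv.piCurry K (fun (i : Fin d) (_ : Fin (k i)) => K)).symm)
  have he : ∀ v x, e v x = quotXPowEquiv K (k x.1) (g (Module.AEval'.of T v) x.1) x.2 :=
    fun v x => rfl
  refine ⟨d, k, e, fun v => funext fun x => ?_⟩
  rw [he, ← Module.AEval'.X_smul_of, map_smul, Pi.smul_apply, quotXPowEquiv_X_smul,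
    nilpotentShift_apply]
  rfl

end Existence

end Jordan

/-! ### Nilpotent orbits and partitions -/

theorem orbitCount_eq_card {G X P : Type*} [Group G] [MulAction G X] (f : P → X)
    (hinj : ∀ p p' (g : G), g • f p = f p' → p = p') (hsurj : ∀ x, ∃ p, ∃ g : G, g • f p = x) :
    orbitCount G X = Nat.card P := by
  refine (Nat.card_eq_of_bijective
    (fun p => (Quotient.mk'' (f p) : MulAction.orbitRel.Quotient G X)) ⟨?_, ?_⟩).symm
  · intro p p' h
    obtain ⟨g, hg⟩ := MulAction.orbitRel_apply.1 (Quotient.eq''.1 h)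
    exact (hinj _ _ g hg).symm
  · intro q
    induction q using Quotient.inductionOn' with
    | h x =>
      obtain ⟨p, g, hg⟩ := hsurj x
      refine ⟨p, Quotient.eq''.2 (MulAction.orbitRel_apply.2 ⟨g⁻¹, ?_⟩)⟩
      rw [← hg]
      exact inv_smul_smul g (f p)

section NilpotentCount
variable {K : Type*} [Field K]

theorem conjAct_smul_eq_iff_comm {ι : Type*} [Fintype ι] [DecidableEq ι] (g : ConjAct (GL ι K))
    (A B : Matrix ι ι K) : g • A = B ↔
      (ConjAct.ofConjAct g).val * A = B * (ConjAct.ofConjAct g).val := by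
  rw [ConjAct.units_smul_def, Units.mul_inv_eq_iff_eq_mul]

theorem exists_smul_eq_iff_endSimilar {ι : Type*} [Fintype ι] [DecidableEq ι]
    (A B : Matrix ι ι K) : (∃ g : ConjAct (GL ι K), g • A = B) ↔
      EndSimilar (Matrix.toLin' A : Module.End K (ι → K)) (Matrix.toLin' B) := by
  constructor
  · rintro ⟨g, hg⟩
    rw [conjAct_smul_eq_iff_comm] at hg
    refine ⟨isUnitEquiv K (ι → K) ⟨Matrix.toLin' (ConjAct.ofConjAct g).val, isUnit_toLin' _⟩,
      fun v => ?_⟩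
    change Matrix.toLin' (ConjAct.ofConjAct g).val (Matrix.toLin' A v) =
      Matrix.toLin' B (Matrix.toLin' (ConjAct.ofConjAct g).val v)
    rw [← Matrix.toLin'_mul_apply, hg, Matrix.toLin'_mul_apply]
  · rintro ⟨e, he⟩
    obtain ⟨g, hg⟩ := exists_toLin'_eq ((isUnitEquiv K (ι → K)).symm e).2
    refine ⟨ConjAct.toConjAct g, (conjAct_smul_eq_iff_comm _ _ _).2 ?_⟩
    apply Matrix.toLin'.injective
    rw [ConjAct.ofConjAct_toConjAct, Matrix.toLin'_mul, Matrix.toLin'_mul, hg]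
    exact LinearMap.ext he

/-- The nilpotent endomorphism of `K ^ n` attached to a partition of `n`. -/
noncomputable def partitionEnd (K : Type*) [Field K] {n : ℕ} (lam : Nat.Partition n) :
    Module.End K (Fin n → K) :=
  (LinearEquiv.ofFinrankEq ((Σ i : lam.parts.ToType, Fin i.1) → K) (Fin n → K) (by
    rw [Module.finrank_fintype_fun_eq_card, Module.finrank_fin_fun, Fintype.card_sigma]
    simp only [Fintype.card_fin]
    refine Eq.trans ?_ lam.parts_sum
    conv_rhs => rw [← Multiset.map_univ_coe lam.parts]
    rfl)).conj (nilpotentShift K fun i : lam.parts.ToType => i.1)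

theorem endSimilar_partitionEnd {n : ℕ} (lam : Nat.Partition n) :
    EndSimilar (nilpotentShift K fun i : lam.parts.ToType => i.1) (partitionEnd K lam) :=
  EndSimilar.conj _ _

theorem isNilpotent_partitionEnd {n : ℕ} (lam : Nat.Partition n) :
    IsNilpotent (partitionEnd K lam) :=
  (isNilpotent_nilpotentShift _).map (LinearEquiv.conjRingEquiv _)

theorem card_filter_coe_eq_count (s : Multiset ℕ) (t : ℕ) :
    (Finset.univ.filter fun i : s.ToType => i.1 = t).card = s.count t := by
  conv_rhs => rw [← Multiset.map_univ_coe s, Multiset.count_map]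
  rw [Finset.card_def, Finset.filter_val]
  simp only [eq_comm]

theorem partition_eq_of_endSimilar {n : ℕ} {lam lam' : Nat.Partition n}
    (h : EndSimilar (partitionEnd K lam) (partitionEnd K lam')) : lam = lam' := by
  have h1 := ((endSimilar_partitionEnd lam).trans h).trans (endSimilar_partitionEnd lam').symm
  have h2 := h1.finrank_ker_pow_eq
  simp only [finrank_ker_nilpotentShift_pow] at h2
  ext t
  rcases Nat.eq_zero_or_pos t with rfl | ht
  · rw [Multiset.count_eq_zero_of_notMem fun h => (lam.parts_pos h).ne rfl,
      Multiset.count_eq_zero_of_notMem fun h => (lam'.parts_pos h).ne rfl]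
  · have h3 := card_filter_eq_of_sum_min_eq h2 ht
    rwa [card_filter_coe_eq_count, card_filter_coe_eq_count] at h3

theorem exists_partition_endSimilar {n : ℕ} {T : Module.End K (Fin n → K)} (hT : IsNilpotent T) :
    ∃ lam : Nat.Partition n, EndSimilar (partitionEnd K lam) T := by
  obtain ⟨d, k, hk⟩ := exists_endSimilar_nilpotentShift hT
  have hsum : (Finset.univ.val.map k).sum = n := by
    obtain ⟨e, -⟩ := hk
    have := e.finrank_eq
    rw [Module.finrank_fin_fun, Module.finrank_fintype_fun_eq_card, Fintype.card_sigma] at this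
    simp only [Fintype.card_fin] at this
    exact this.symm
  -- The decomposition may contain trivial blocks; `ofSums` drops the zeros, and only positive sizes
  -- affect similarity.
  let lam := Nat.Partition.ofSums n (Finset.univ.val.map k) hsum
  refine ⟨lam, (endSimilar_partitionEnd lam).symm.trans
    (EndSimilar.trans (endSimilar_nilpotentShift fun t ht => ?_) hk.symm)⟩
  rw [card_filter_coe_eq_count, Nat.Partition.count_ofSums_of_ne_zero hsum ht.ne',
    Multiset.count_map, Finset.card_def, Finset.filter_val]
  simp only [eq_comm]

theorem mem_classMatrices {F : Set (AlgebraicClosure K)} {ι : Type*} [Fintype ι] [DecidableEq ι]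
    {A : Matrix ι ι K} : A ∈ classMatrices F ι ↔ IsClassEnd F (Matrix.toLin' A) := Iff.rfl

/-- The Jordan matrices of partitions represent all orbits, once each: kernel dimensions of powers
recover the partition. -/
theorem classCount_singleton_zero (n : ℕ) :
    classCount ({0} : Set (AlgebraicClosure K)) n = Fintype.card (Nat.Partition n) := by
  rw [← Nat.card_eq_fintype_card, classCount]
  have hmem : ∀ lam : Nat.Partition n, LinearMap.toMatrix' (partitionEnd K lam) ∈
      classMatrices ({0} : Set (AlgebraicClosure K)) (Fin n) := fun lam => by
    rw [mem_classMatrices, Matrix.toLin'_toMatrix', ← isNilpotent_iff_isClassEnd]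
    exact isNilpotent_partitionEnd lam
  refine orbitCount_eq_card (fun lam => ⟨_, hmem lam⟩) (fun lam lam' g hg => ?_) fun B => ?_
  · have h1 := (exists_smul_eq_iff_endSimilar _ _).1 ⟨g, congrArg Subtype.val hg⟩
    simp only [Matrix.toLin'_toMatrix'] at h1
    exact partition_eq_of_endSimilar h1
  · obtain ⟨lam, hlam⟩ := exists_partition_endSimilar (isNilpotent_iff_isClassEnd.2 B.2)
    rw [← Matrix.toLin'_toMatrix' (partitionEnd K lam)] at hlam
    obtain ⟨g, hg⟩ := (exists_smul_eq_iff_endSimilar _ _).2 hlam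
    exact ⟨lam, g, Subtype.ext hg⟩

theorem rho_eq_blockClassCount (l : List ℕ) :
    rho K l = blockClassCount ({0} : Set (AlgebraicClosure K)) l := by
  have : nilpotentMatrices K (BlockIndex l) =
      classMatrices ({0} : Set (AlgebraicClosure K)) (BlockIndex l) := by
    ext A
    change IsNilpotent A ↔ IsClassEnd _ (Matrix.toLin' A)
    rw [← isNilpotent_iff_isClassEnd]
    exact (IsNilpotent.map_iff (f := Matrix.toLinAlgEquiv' (R := K)) (AlgEquiv.injective _)).symm
  rw [rho, this, blockClassCount]

end NilpotentCount

/-! ### The theorem -/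

theorem mainTheorem1 {K : Type*} [Field K] [Finite K] (k m : ℕ) (hk : 0 < k) (hm : 0 < m) :
    (∀ F : Set (AlgebraicClosure K),
      kappa F (k + m) (Nat.Partition.indiscrete k) =
        ∑ j ∈ Finset.range (k + 1),
          classCount F (k - j) * ∑ lam ∈ boundedPartitions j m, kappa F m lam) ∧
    rho K [k, m] =
      ∑ j ∈ Finset.range (k + 1),
        Fintype.card (Nat.Partition (k - j)) * ∑ lam ∈ boundedPartitions j m, nu K m lam := by
  refine ⟨fun F => ?_, ?_⟩
  · rw [← blockClassCount_pair, ← delta_indiscrete hk m]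
    rfl
  · rw [rho_eq_blockClassCount, blockClassCount_pair]
    simp only [classCount_singleton_zero, nu, rho_eq_blockClassCount]
    rfl
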